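/- Let $k$ be an algebraically closed field and let $n \ge 2$. Let $P_n=\{x_1,\dots,x_n\}$ be the star poset: $x_1<x_j$ for all $j\ge 2$, and $x_2,\dots,x_n$ are pairwise incomparable. Let $I(P_n)$ be its incidence monoid, i.e. the multiplicative monoid of the incidence algebra of $P_n$ over $k$. Its elements are identified with the $n\times n$ matrices $x=(x_{ij})$ over $k$ with $x_{ij}=0$ unless $i=j$ or $i=1$. Let $G=G(P_n)$ be its unit group, $Z(G)$ the centre of $G$, and $T\subseteq G$ the subgroup of diagonal matrices. A group $H\times H$ with $H\le G$ acts on $I(P_n)$ by $(a,b)\cdot x=axb^{-1}$. The adherence order on the set of orbits is given by inclusion of Zariski closures of orbits. Then $T$ is a maximal torus of $G$, and the following hold. 1. $I(P_n)$ is a smooth variety of dimension $2n-1$, and it is toric with respect to $T\times T$: it is irreducible and normal, and the field of $T\times T$-invariant rational functions has transcendence degree $0$ over $k$. 2. The group of algebraic semigroup automorphisms of $I(P_n)$ (the multiplicative bijections that are isomorphisms of varieties) is isomorphic to $(G/Z(G))\rtimes S_{n-1}$, where $S_{n-1}$ acts by permuting $x_2,\dots,x_n$; the class of $g\in G$ together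 with $\sigma\in S_{n-1}$ corresponds to the automorphism $x\mapsto g\,\sigma(x)\,g^{-1}$. 3. The adherence order on the $T\times T$-orbits of $I(P_n)$ is isomorphic to the Boolean lattice of all subsets of a $(2n-1)$-element set. In particular there are $2^{2n-1}$ such orbits. 4. Let $R$ be the set of 0/1 matrices $y\in I(P_n)$ with at most one $1$ in each column and such that $y_{11}=1$ implies $y_{1j}=0$ for all $j\ge 2$. Every $G\times G$-orbit in $I(P_n)$ contains exactly one element of $R$. The adherence order on the set of $G\times G$-orbits is a partial order in which every maximal chain has exactly $2n$ elements. Its rank function is the dimension of the orbit, and for $y\in R$ the orbit of $y$ has rank and dimension $$\rho(y)=\begin{cases} n-1+\#\{i\ge 1: y_{ii}=1\} & \text{if } y_{11}=1,\\ 2\,\#\{i\ge 2: y_{ii}=1\}+\#\{i\ge 2: y_{1i}=1\} & \text{if } y_{11}=0;\end{cases}$$ in particular $\rho(x)=\rho(y)+1$ whenever the orbit of $x$ covers the orbit of $y$. For $x,y\in R$, the orbit of $y$ is covered by the orbit of $x$ if and only if one of the following holds: (a) $x_{11}=y_{11}=1$ and there is $r\ge 2$ with $x_{rr}=1$, $y_{rr}=0$,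 and $x_{ij}=y_{ij}$ for all $(i,j)\ne(r,r)$; (b) $x_{11}=1$, $y_{11}=0$, and for all $j\ge 2$: $x_{jj}=y_{jj}$, and $y_{1j}=1$ if and only if $x_{jj}=0$; (c) $x_{11}=y_{11}=0$ and there is $r\ge 2$ with $x_{rr}=1$, $x_{1r}=0$, $y_{rr}=0$, $y_{1r}=1$, and $x_{ij}=y_{ij}$ for all $(i,j)\ne(1,r),(r,r)$; (d) $x_{11}=y_{11}=0$ and there is $r\ge 2$ with $x_{1r}=1$, $y_{1r}=0$, and $x_{ij}=y_{ij}$ for all $(i,j)\ne(1,r)$. In particular there are $2^{n-1}+3^{n-1}$ orbits of $G\times G$ in $I(P_n)$. -/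

import Mathlib

/-! ### Finite-dimensional vector spaces as affine varieties -/

section AffineSpace

variable (k : Type*) [Field k]

/-- The coordinate ring of a finite-dimensional `k`-vector space `V`, viewed as an affine variety
over the (infinite) field `k`: the algebra of polynomial functions on `V`, i.e. the algebra of
functions generated by the linear functionals. -/
def regularFunctions (V : Type*) [AddCommGroup V] [Module k V] : Subalgebra k (V → k) :=
  Algebra.adjoin k (Set.range fun φ : Module.Dual k V => (φ : V → k))

theorem regularFunctions_comp_linear {V W : Type*} [AddCommGroup V] [Module k V]
    [AddCommGroup W] [Module k W] (L : V →ₗ[k] W) {f : W → k}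
    (hf : f ∈ regularFunctions k W) : f ∘ L ∈ regularFunctions k V := by
  unfold regularFunctions at hf ⊢
  induction hf using Algebra.adjoin_induction with
  | mem x hx =>
    obtain ⟨φ, rfl⟩ := hx
    exact Algebra.subset_adjoin ⟨φ.comp L, rfl⟩
  | algebraMap r => exact Subalgebra.algebraMap_mem _ r
  | add x y _ _ hx hy => exact Subalgebra.add_mem _ hx hy
  | mul x y _ _ hx hy => exact Subalgebra.mul_mem _ hx hy

variable {V : Type*} [AddCommGroup V] [Module k V]

/-- The ideal of all regular functions vanishing on a subset of `V`. -/
def vanishingIdealOf (S : Set V) : Ideal (regularFunctions k V) where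
  carrier := {f | ∀ x ∈ S, (f : V → k) x = 0}
  add_mem' := by
    intro f g hf hg x hx
    simp [hf x hx, hg x hx]
  zero_mem' := by
    intro x _
    simp
  smul_mem' := by
    intro c f hf x hx
    simp [hf x hx]

/-- The Zariski closure of a subset of `V`. -/
def zariskiClosure (S : Set V) : Set V :=
  {x | ∀ f ∈ vanishingIdealOf k S, (f : V → k) x = 0}

/-- The dimension of the Zariski closure of a subset `S` of `V` (for an orbit of an algebraic group
this is the dimension of the orbit): the Krull dimension of the coordinate ring of the closure. -/
noncomputable def zariskiDim (S : Set V) : WithBot ℕ∞ :=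
  ringKrullDim (regularFunctions k V ⧸ vanishingIdealOf k S)

/-- Pull-back of regular functions along a linear automorphism. -/
def regularPullback (L : V ≃ₗ[k] V) : regularFunctions k V ≃ₐ[k] regularFunctions k V where
  toFun f := ⟨(f : V → k) ∘ L, regularFunctions_comp_linear k L.toLinearMap f.2⟩
  invFun f := ⟨(f : V → k) ∘ L.symm, regularFunctions_comp_linear k L.symm.toLinearMap f.2⟩
  left_inv f := by ext x; simp
  right_inv f := by ext x; simp
  map_mul' _ _ := rfl
  map_add' _ _ := rfl
  commutes' _ := rfl

/-- Pull-back of rational functions along a linear automorphism. -/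
noncomputable def rationalPullback (L : V ≃ₗ[k] V) :
    FractionRing (regularFunctions k V) ≃ₐ[k] FractionRing (regularFunctions k V) :=
  IsLocalization.algEquivOfAlgEquiv (A := k) (M := nonZeroDivisors (regularFunctions k V))
    (T := nonZeroDivisors (regularFunctions k V))
    (FractionRing (regularFunctions k V)) (FractionRing (regularFunctions k V))
    (regularPullback k L) (MulEquivClass.map_nonZeroDivisors (regularPullback k L))

/-- The rational functions on `V` that are invariant under a group of linear automorphisms. -/
noncomputable def rationalInvariants (Γ : Subgroup (V ≃ₗ[k] V)) :
    Subalgebra k (FractionRing (regularFunctions k V)) :=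
  ⨅ γ ∈ Γ, AlgHom.equalizer (rationalPullback k γ).toAlgHom (AlgHom.id k _)

/-- The complexity of a torus action: the transcendence degree over `k` of the field of invariant
rational functions (a torus is its own Borel subgroup). -/
noncomputable def torusComplexity (Γ : Subgroup (V ≃ₗ[k] V)) : Cardinal :=
  Algebra.trdeg k (rationalInvariants k Γ)

/-- The variety `V` with the action of a torus, acting through the group `Γ` of linear
automorphisms, is toric: it is irreducible and normal, and the action has complexity zero. -/
structure IsToricFor (Γ : Subgroup (V ≃ₗ[k] V)) : Prop where
  irreducible : IsDomain (regularFunctions k V)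
  normal : IsIntegrallyClosed (regularFunctions k V)
  complexity_eq_zero : torusComplexity k Γ = 0

/-- The set of orbits of a group of linear automorphisms of `V`. -/
def OrbitSet (Γ : Subgroup (V ≃ₗ[k] V)) : Type _ := MulAction.orbitRel.Quotient Γ V

variable {k}

/-- The orbit of `x`, as an element of the set of orbits. -/
def orbitOf (Γ : Subgroup (V ≃ₗ[k] V)) (x : V) : OrbitSet k Γ :=
  Quotient.mk (MulAction.orbitRel Γ V) x

/-- The underlying subset of `V` of an orbit. -/
def OrbitSet.toSet {Γ : Subgroup (V ≃ₗ[k] V)} (O : OrbitSet k Γ) : Set V :=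
  MulAction.orbitRel.Quotient.orbit O

/-- The adherence order: `O ≤ O'` iff the Zariski closure of `O` is contained in that of `O'`. -/
instance {Γ : Subgroup (V ≃ₗ[k] V)} : Preorder (OrbitSet k Γ) :=
  Preorder.lift fun O => zariskiClosure k O.toSet

end AffineSpace

/-! ### Algebraic monoids of finite-dimensional algebras -/

section AlgebraMonoid

variable (k : Type*) [Field k] (A : Type*) [Ring A] [Algebra k A]

/-- The group of algebraic semigroup automorphisms of the multiplicative monoid of `A`: the
multiplicative bijections that are isomorphisms of varieties. -/
def algebraicAut : Subgroup (MulAut A) where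
  carrier := {F | (∀ f ∈ regularFunctions k A, f ∘ F ∈ regularFunctions k A) ∧
    ∀ f ∈ regularFunctions k A, f ∘ F.symm ∈ regularFunctions k A}
  mul_mem' := by
    rintro F G ⟨hF, hF'⟩ ⟨hG, hG'⟩
    exact ⟨fun f hf => hG _ (hF f hf), fun f hf => hF' _ (hG' f hf)⟩
  one_mem' := ⟨fun f hf => hf, fun f hf => hf⟩
  inv_mem' := by
    rintro F ⟨hF, hF'⟩
    exact ⟨hF', hF⟩

variable {A}

/-- The coordinate ring of a closed subgroup `S` of the linear algebraic group `Aˣ`: the algebra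
of functions on `S` generated by the linear coordinates of `u` and of `u⁻¹`. -/
def groupRegularFunctions (S : Subgroup Aˣ) : Subalgebra k (S → k) :=
  Algebra.adjoin k
    ((Set.range fun (φ : Module.Dual k A) (u : S) => φ ((u : Aˣ) : A)) ∪
      Set.range fun (φ : Module.Dual k A) (u : S) => φ (((u : Aˣ)⁻¹ : Aˣ) : A))

/-- `S` is a torus: it is isomorphic, as an algebraic group, to `(kˣ) ^ m` for some `m`, the latter
being the unit group of the algebra `k ^ m`. -/
def IsTorus (S : Subgroup Aˣ) : Prop :=
  ∃ (m : ℕ) (e : S ≃* (⊤ : Subgroup (Fin m → k)ˣ)),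
    (∀ f ∈ groupRegularFunctions k (⊤ : Subgroup (Fin m → k)ˣ),
      f ∘ e ∈ groupRegularFunctions k S) ∧
    ∀ f ∈ groupRegularFunctions k S,
      f ∘ e.symm ∈ groupRegularFunctions k (⊤ : Subgroup (Fin m → k)ˣ)

variable (A) in
/-- The action of `Aˣ × Aˣ` on `A` by `(a, b) • x = a x b⁻¹`. -/
def doubleAction : Aˣ × Aˣ →* (A ≃ₗ[k] A) where
  toFun g :=
    { toFun := fun x => g.1 * x * (g.2⁻¹ : Aˣ)
      invFun := fun x => (g.1⁻¹ : Aˣ) * x * g.2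
      map_add' := fun x y => by rw [mul_add, add_mul]
      map_smul' := fun c x => by simp
      left_inv := fun x => by simp [mul_assoc]
      right_inv := fun x => by simp [mul_assoc] }
  map_one' := by
    ext x
    simp
  map_mul' g h := by
    ext x
    simp [mul_assoc]

/-- The group of transformations of `A` through which `S × S` acts. -/
def doubleGroup (S : Subgroup Aˣ) : Subgroup (A ≃ₗ[k] A) := (S.prod S).map (doubleAction k A)

end AlgebraMonoid

/-- The automorphisms of a group act on the quotient by its centre. -/
def mulAutModCenter (G : Type*) [Group G] : MulAut G →* MulAut (G ⧸ Subgroup.center G) where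
  toFun f := QuotientGroup.congr _ _ f
    (Subgroup.characteristic_iff_map_eq.mp inferInstance f)
  map_one' := by
    ext x
    induction x using QuotientGroup.induction_on
    rfl
  map_mul' f g := by
    ext x
    induction x using QuotientGroup.induction_on
    rfl

/-- The automorphisms of a monoid act on its group of units. -/
def mulAutUnits (M : Type*) [Monoid M] : MulAut M →* MulAut Mˣ where
  toFun f := Units.mapEquiv f
  map_one' := rfl
  map_mul' _ _ := rfl

/-! ### The star poset and its incidence monoid -/

/-- The star poset on `n ≥ 1` vertices: a least element, the root, together with `n - 1` pairwise
incomparable elements, the leaves. -/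
def StarPoset (n : ℕ) : Type := Option (Fin (n - 1))

namespace StarPoset

variable {n : ℕ}

/-- The least element. -/
def root : StarPoset n := none

/-- The maximal elements. -/
def leaf (j : Fin (n - 1)) : StarPoset n := some j

instance : DecidableEq (StarPoset n) := inferInstanceAs (DecidableEq (Option (Fin (n - 1))))

instance : Fintype (StarPoset n) := inferInstanceAs (Fintype (Option (Fin (n - 1))))

instance : PartialOrder (StarPoset n) where
  le x y := x = root ∨ x = y
  le_refl _ := Or.inr rfl
  le_trans := by
    rintro x y z (rfl | rfl) h
    · exact Or.inl rfl
    · exact h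
  le_antisymm := by
    rintro x y (rfl | rfl) (h | h) <;> simp_all

instance : DecidableLE (StarPoset n) := fun x y => inferInstanceAs (Decidable (x = root ∨ x = y))

instance : DecidableLT (StarPoset n) := fun x y =>
  decidable_of_iff (x ≤ y ∧ ¬y ≤ x) lt_iff_le_not_ge.symm

instance : LocallyFiniteOrder (StarPoset n) := Fintype.toLocallyFiniteOrder

/-- A permutation of the leaves, as an automorphism of the star poset. -/
def permIso (σ : Equiv.Perm (Fin (n - 1))) : StarPoset n ≃o StarPoset n where
  toEquiv := Equiv.optionCongr σ
  map_rel_iff' := by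
    rintro (_ | x) (_ | y)
    · exact Iff.rfl
    · exact ⟨fun _ => Or.inl rfl, fun _ => Or.inl rfl⟩
    · constructor <;> rintro (h | h) <;> cases h
    · constructor
      · rintro (h | h)
        · cases h
        · exact Or.inr (congrArg some (σ.injective (Option.some.inj h)))
      · rintro (h | h)
        · cases h
        · cases h
          exact Or.inr rfl

end StarPoset

open StarPoset

/-- The incidence algebra (and incidence monoid) of the star poset. -/
abbrev StarMonoid (k : Type*) [Field k] (n : ℕ) : Type _ := IncidenceAlgebra k (StarPoset n)

section StarMonoid

variable (k : Type*) [Field k] (n : ℕ)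

/-- The subgroup of diagonal elements of the unit group of the incidence algebra. -/
def diagonalTorus : Subgroup (StarMonoid k n)ˣ where
  carrier := {u | ∀ i j : StarPoset n, i ≠ j →
    (u : StarMonoid k n) i j = 0 ∧ ((u⁻¹ : (StarMonoid k n)ˣ) : StarMonoid k n) i j = 0}
  mul_mem' := by
    have key : ∀ f g : StarMonoid k n, (∀ i j, i ≠ j → f i j = 0) → (∀ i j, i ≠ j → g i j = 0) →
        ∀ i j, i ≠ j → (f * g) i j = 0 := by
      intro f g hf hg i j hij
      rw [IncidenceAlgebra.mul_apply]
      refine Finset.sum_eq_zero fun x _ => ?_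
      by_cases h : i = x
      · subst h
        rw [hg _ _ hij, mul_zero]
      · rw [hf _ _ h, zero_mul]
    intro u v hu hv i j hij
    refine ⟨?_, ?_⟩
    · rw [Units.val_mul]
      exact key _ _ (fun i j h => (hu i j h).1) (fun i j h => (hv i j h).1) i j hij
    · rw [mul_inv_rev, Units.val_mul]
      exact key _ _ (fun i j h => (hv i j h).2) (fun i j h => (hu i j h).2) i j hij
  one_mem' := by
    intro i j hij
    simp [IncidenceAlgebra.one_apply, hij]
  inv_mem' := by
    intro u hu i j hij
    exact ⟨(hu i j hij).2, by simpa using (hu i j hij).1⟩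

/-- The action of the permutations of the leaves on the incidence monoid by permuting the entries:
`(σ f) (x, y) = f (σ⁻¹ x, σ⁻¹ y)`. -/
def permAction : Equiv.Perm (Fin (n - 1)) →* MulAut (StarMonoid k n) where
  toFun σ :=
    { toFun := fun f =>
        ⟨fun x y => f ((permIso σ).symm x) ((permIso σ).symm y), fun x y h =>
          IncidenceAlgebra.apply_eq_zero_of_not_le
            (fun h' => h ((permIso σ).symm.le_iff_le.mp h')) f⟩
      invFun := fun f =>
        ⟨fun x y => f (permIso σ x) (permIso σ y), fun x y h =>
          IncidenceAlgebra.apply_eq_zero_of_not_le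
            (fun h' => h ((permIso σ).le_iff_le.mp h')) f⟩
      left_inv := fun f => by
        ext x y
        simp
      right_inv := fun f => by
        ext x y
        simp
      map_mul' := fun f g => by
        ext x y
        simp only [IncidenceAlgebra.mul_apply, IncidenceAlgebra.coe_mk]
        refine (Finset.sum_equiv (permIso σ).symm.toEquiv ?_ ?_).symm
        · intro z
          simp [Finset.mem_Icc]
        · intro z _
          rfl }
  map_one' := by
    ext f x y
    rcases x with _ | x <;> rcases y with _ | y <;> rfl
  map_mul' σ τ := by
    ext f x y
    rcases x with _ | x <;> rcases y with _ | y <;> rfl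

/-- The induced action of the permutations of the leaves on the unit group modulo its centre. -/
def permActionUnitsModCenter : Equiv.Perm (Fin (n - 1)) →*
    MulAut ((StarMonoid k n)ˣ ⧸ Subgroup.center (StarMonoid k n)ˣ) :=
  (mulAutModCenter _).comp ((mulAutUnits _).comp (permAction k n))

/-- The normal forms of the orbits of `G × G`, where `G` is the unit group: the 0/1 matrices with at
most one 1 in each column and such that the first row has no further 1 if its first entry is 1. -/
def orbitNormalForms : Set (StarMonoid k n) :=
  {y | (∀ i j, y i j = 0 ∨ y i j = 1) ∧ (∀ i i' j, y i j = 1 → y i' j = 1 → i = i') ∧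
    (y root root = 1 → ∀ j, y root (leaf j) = 0)}

variable {k n}

/-- The set of `T × T`-orbits, where `T` is the diagonal torus. -/
abbrev TorusOrbits (k : Type*) [Field k] (n : ℕ) : Type _ :=
  OrbitSet k (doubleGroup k (diagonalTorus k n))

/-- The set of `G × G`-orbits, where `G` is the unit group. -/
abbrev UnitOrbits (k : Type*) [Field k] (n : ℕ) : Type _ :=
  OrbitSet k (doubleGroup k (⊤ : Subgroup (StarMonoid k n)ˣ))

/-- The `G × G`-orbit of an element, where `G` is the unit group. -/
abbrev unitOrbit (x : StarMonoid k n) : UnitOrbits k n :=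
  orbitOf (doubleGroup k (⊤ : Subgroup (StarMonoid k n)ˣ)) x

open Classical in
/-- The rank of a normal form. -/
noncomputable def orbitRank (y : StarMonoid k n) : ℕ :=
  if y root root = 1 then n - 1 + {i : StarPoset n | y i i = 1}.ncard
  else 2 * {j : Fin (n - 1) | y (leaf j) (leaf j) = 1}.ncard +
    {j : Fin (n - 1) | y root (leaf j) = 1}.ncard

/-- The covering relations between normal forms (`y` is covered by `x`): exactly one leaf `r`
changes in one of three ways, or the entry at the root changes and the first row fills up. -/
inductive NormalFormCover (y x : StarMonoid k n) : Prop
  | diagonal (r : Fin (n - 1)) (hx₁ : x root root = 1) (hy₁ : y root root = 1)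
      (hx : x (leaf r) (leaf r) = 1) (hy : y (leaf r) (leaf r) = 0)
      (h : ∀ i j, (i, j) ≠ (leaf r, leaf r) → x i j = y i j)
  | corner (hx₁ : x root root = 1) (hy₁ : y root root = 0)
      (h : ∀ j, x (leaf j) (leaf j) = y (leaf j) (leaf j))
      (hy : ∀ j, y root (leaf j) = 1 ↔ x (leaf j) (leaf j) = 0)
  | lift (r : Fin (n - 1)) (hx₁ : x root root = 0) (hy₁ : y root root = 0)
      (hx : x (leaf r) (leaf r) = 1) (hx' : x root (leaf r) = 0)
      (hy : y (leaf r) (leaf r) = 0) (hy' : y root (leaf r) = 1)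
      (h : ∀ i j, (i, j) ≠ (root, leaf r) → (i, j) ≠ (leaf r, leaf r) → x i j = y i j)
  | delete (r : Fin (n - 1)) (hx₁ : x root root = 0) (hy₁ : y root root = 0)
      (hx : x root (leaf r) = 1) (hy : y root (leaf r) = 0)
      (h : ∀ i j, (i, j) ≠ (root, leaf r) → x i j = y i j)

end StarMonoid

/-!
The incidence algebra of the star is a vector space whose coordinates are the `2 n - 1` matrix
entries `x₁₁`, `x₁ⱼ` and `xⱼⱼ` for `j ≥ 2`, so its coordinate ring is a polynomial ring. This gives
smoothness, normality and the dimension (`polyEquivRegular` and the lemmas after it).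

*Orbits.* All the orbit closures that occur are coordinate subspaces. The notion `IsOrbitType`
captures this: orbits are classified by a set `C x` of coordinates, the orbit of `x` lies in the
subspace spanned by `C x` and contains all points whose nonzero coordinates are exactly those in
`C x`. As the latter points are dense in the subspace, the adherence order is the inclusion order on
the possible sets `C x`, and the dimension of an orbit is the number of elements of `C x`.

* `T × T` rescales the `2 n - 1` entries independently (`exists_scaling`). So `C x` is the set of
  positions of nonzero entries and takes every value: the order is Boolean. An invariant rational
  function is constant on a dense orbit, hence constant (`torusComplexity_eq_zero`).
* For `G × G`, row and column operations allow `C x` to be the *lower set* generated by the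
  positions of nonzero entries (`isOrbitType_unitType`), in the order in which `(1, j)` lies below
  `(1, 1)` and below `(j, j)`, for `j ≥ 2`. Every inclusion of lower sets is refined by adding one
  position at a time (`isOneStepFamily_starLowerSets`). Hence covers are the pairs differing by one
  position, the rank is the cardinality, and maximal chains have `(2 n - 1) + 1` elements. Each lower set `C` has a
  unique 0/1 normal form (`normalForm`), and translating "add one position" to normal forms gives
  the covering relations (`normalFormCover_iff`).

*Maximal torus.* A torus is commutative, and the diagonal torus is its own centralizer.

*Automorphisms.* A multiplicative bijection `F` maps the diagonal matrix units `E_{pp}` to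
orthogonal nonzero idempotents. Their diagonals are the unit vectors, so that `F` permutes the
`E_{pp}` up to conjugation by one unipotent matrix; as `E_{pp} M E_{qq} ≠ 0` for distinct `p` and `q` only if
`p = 1`, the root is fixed (`exists_map_diagUnit`). This reduces the problem to `F` fixing all
`E_{pp}`. On the centre, a line, `F` is an isomorphism of varieties fixing `0` and `1`, hence the
identity, so `F` commutes with scalars (`algebraicAut_map_smul`). The Peirce components
`E_{pp} x E_{qq}` then show that `F` only rescales the entries `x₁ⱼ`, that is, `F` is a diagonal
conjugation (`eq_unitsConj_of_map_diagUnit`).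
-/

/-! ### Polynomial functions in linear coordinates -/

section Coordinates

variable {k : Type*} [Field k] {V : Type*} [AddCommGroup V] [Module k V] {ι : Type*}

theorem dual_mem_regularFunctions (φ : Module.Dual k V) : (φ : V → k) ∈ regularFunctions k V :=
  Algebra.subset_adjoin ⟨φ, rfl⟩

/-- The algebra map from the polynomial ring to the regular functions on `V` that sends the
variables to the coordinates of a linear coordinate system `c`. -/
noncomputable def polyToRegular (c : V ≃ₗ[k] (ι → k)) :
    MvPolynomial ι k →ₐ[k] regularFunctions k V :=
  MvPolynomial.aeval fun i =>
    ⟨fun x => c x i, dual_mem_regularFunctions ((LinearMap.proj i).comp c.toLinearMap)⟩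

theorem polyToRegular_apply (c : V ≃ₗ[k] (ι → k)) (p : MvPolynomial ι k) (x : V) :
    (polyToRegular c p : V → k) x = MvPolynomial.eval (c x) p := by
  induction p using MvPolynomial.induction_on with
  | C a => simp [polyToRegular]
  | add p q hp hq => simp [hp, hq]
  | mul_X p i hp =>
    rw [map_mul, map_mul, MvPolynomial.eval_X, ← hp]
    exact congrArg (((polyToRegular c p : V → k) x) * ·) (by simp [polyToRegular])

variable [Finite ι]

theorem polyToRegular_surjective (c : V ≃ₗ[k] (ι → k)) : Function.Surjective (polyToRegular c) := by
  classical
  have := Fintype.ofFinite ι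
  rintro ⟨f, hf⟩
  unfold regularFunctions at hf
  suffices ∃ p, ∀ x, MvPolynomial.eval (c x) p = f x by
    obtain ⟨p, hp⟩ := this
    exact ⟨p, Subtype.ext (funext fun x => (polyToRegular_apply c p x).trans (hp x))⟩
  induction hf using Algebra.adjoin_induction with
  | mem f hf =>
    obtain ⟨φ, rfl⟩ := hf
    refine ⟨∑ i, MvPolynomial.C (φ (c.symm (Pi.single i 1))) * MvPolynomial.X i, fun x => ?_⟩
    have : x = ∑ i, c x i • c.symm (Pi.single i 1) := by
      apply c.injective
      ext j
      simp [Finset.sum_apply, Pi.single_apply]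
    conv_rhs => rw [this]
    simp [mul_comm]
  | algebraMap r => exact ⟨MvPolynomial.C r, fun x => by simp⟩
  | add f g _ _ hf hg =>
    obtain ⟨p, hp⟩ := hf
    obtain ⟨q, hq⟩ := hg
    exact ⟨p + q, fun x => by simp [hp, hq]⟩
  | mul f g _ _ hf hg =>
    obtain ⟨p, hp⟩ := hf
    obtain ⟨q, hq⟩ := hg
    exact ⟨p * q, fun x => by simp [hp, hq]⟩

variable [Infinite k]

/-- Over an infinite field the open torus, where no coordinate vanishes, is Zariski dense. -/
theorem mvPolynomial_eq_zero_of_forall_ne_zero (p : MvPolynomial ι k)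
    (h : ∀ x : ι → k, (∀ i, x i ≠ 0) → MvPolynomial.eval x p = 0) : p = 0 := by
  have := Fintype.ofFinite ι
  have hp : p * ∏ i, MvPolynomial.X i = 0 := by
    refine MvPolynomial.funext fun x => ?_
    by_cases hx : ∀ i, x i ≠ 0
    · simp [h x hx]
    · push Not at hx
      obtain ⟨i, hi⟩ := hx
      have : ∏ i, x i = 0 := Finset.prod_eq_zero (Finset.mem_univ i) hi
      simp [map_prod, this]
  refine (mul_eq_zero.mp hp).resolve_right ?_
  exact Finset.prod_ne_zero_iff.mpr fun i _ => MvPolynomial.X_ne_zero i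

omit [Finite ι] in
theorem polyToRegular_injective (c : V ≃ₗ[k] (ι → k)) : Function.Injective (polyToRegular c) := by
  intro p q hpq
  refine MvPolynomial.funext fun x => ?_
  have := congrArg (fun f : regularFunctions k V => (f : V → k) (c.symm x)) hpq
  simpa [polyToRegular_apply] using this

/-- The coordinate ring of a vector space over an infinite field is a polynomial ring. -/
noncomputable def polyEquivRegular (c : V ≃ₗ[k] (ι → k)) :
    MvPolynomial ι k ≃ₐ[k] regularFunctions k V :=
  AlgEquiv.ofBijective (polyToRegular c) ⟨polyToRegular_injective c, polyToRegular_surjective c⟩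

theorem regularFunctions_isDomain (c : V ≃ₗ[k] (ι → k)) : IsDomain (regularFunctions k V) :=
  (polyEquivRegular c).symm.toMulEquiv.isDomain _

theorem regularFunctions_isIntegrallyClosed (c : V ≃ₗ[k] (ι → k)) :
    IsIntegrallyClosed (regularFunctions k V) :=
  IsIntegrallyClosed.of_equiv (polyEquivRegular c).toRingEquiv

theorem regularFunctions_smooth (c : V ≃ₗ[k] (ι → k)) :
    Algebra.Smooth k (regularFunctions k V) :=
  have : Algebra.Smooth k (MvPolynomial ι k) := { }
  Algebra.Smooth.of_equiv (polyEquivRegular c)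

theorem ringKrullDim_regularFunctions (c : V ≃ₗ[k] (ι → k)) :
    ringKrullDim (regularFunctions k V) = (Nat.card ι : WithBot ℕ∞) := by
  rw [← ringKrullDim_eq_of_ringEquiv (polyEquivRegular c).toRingEquiv,
    MvPolynomial.ringKrullDim_of_isNoetherianRing, ringKrullDim_eq_zero_of_field, zero_add]

theorem regularFunction_eq_of_eqOn_torus (c : V ≃ₗ[k] (ι → k)) (f g : regularFunctions k V)
    (h : ∀ x, (∀ i, c x i ≠ 0) → (f : V → k) x = (g : V → k) x) : f = g := by
  obtain ⟨p, hp⟩ := polyToRegular_surjective c (f - g)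
  rw [← sub_eq_zero, ← hp, mvPolynomial_eq_zero_of_forall_ne_zero p, map_zero]
  intro x hx
  have := polyToRegular_apply c p (c.symm x)
  rw [hp] at this
  simpa [h (c.symm x) (by simpa using hx)] using this.symm

/-- If a group of linear maps contains all rescalings of the coordinates, every invariant rational
function is constant: restricted to the orbit of a general point, which is dense, it is constant. -/
theorem torusComplexity_eq_zero (c : V ≃ₗ[k] (ι → k)) (Γ : Subgroup (V ≃ₗ[k] V))
    (hΓ : ∀ t : ι → k, (∀ i, t i ≠ 0) → ∃ γ ∈ Γ, ∀ x i, c (γ x) i = t i * c x i) :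
    torusComplexity k Γ = 0 := by
  have := regularFunctions_isDomain c
  have hbot : rationalInvariants k Γ = ⊥ := by
    rw [eq_bot_iff]
    intro f hf
    obtain ⟨p, q, hq, rfl⟩ := IsFractionRing.div_surjective (A := regularFunctions k V) f
    have hq0 : q ≠ 0 := nonZeroDivisors.ne_zero hq
    have hq' : algebraMap _ (FractionRing (regularFunctions k V)) q ≠ 0 :=
      IsFractionRing.to_map_ne_zero_of_mem_nonZeroDivisors hq
    have hinv : ∀ γ ∈ Γ, ∀ x, (p : V → k) (γ x) * (q : V → k) x =
        (p : V → k) x * (q : V → k) (γ x) := by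
      intro γ hγ x
      have h1 : rationalPullback k γ (algebraMap _ _ p / algebraMap _ _ q) =
          algebraMap _ _ p / algebraMap _ _ q := by
        simp only [rationalInvariants, Algebra.mem_iInf] at hf
        exact hf γ hγ
      have h2 : ∀ r : regularFunctions k V, rationalPullback k γ (algebraMap _ _ r) =
          algebraMap _ _ (regularPullback k γ r) := fun r =>
        IsLocalization.algEquivOfAlgEquiv_eq _ r
      rw [map_div₀, h2, h2, div_eq_div_iff, ← map_mul, ← map_mul] at h1
      · have h3 := IsFractionRing.injective (regularFunctions k V) _ h1
        exact congrArg (fun f : regularFunctions k V => (f : V → k) x) h3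
      · exact IsFractionRing.to_map_ne_zero_of_mem_nonZeroDivisors
          (mem_nonZeroDivisors_of_ne_zero
            ((map_ne_zero_iff _ (regularPullback k γ).injective).mpr hq0))
      · exact hq'
    -- the quotient `p / q` is constant on the dense orbit of `x₀`
    obtain ⟨x₀, hx₀, hqx₀⟩ : ∃ x, (∀ i, c x i ≠ 0) ∧ (q : V → k) x ≠ 0 := by
      by_contra! h
      exact hq0 (regularFunction_eq_of_eqOn_torus c q 0 h)
    have hpq : p = algebraMap k _ ((p : V → k) x₀ / (q : V → k) x₀) * q := by
      refine regularFunction_eq_of_eqOn_torus c _ _ fun y hy => ?_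
      obtain ⟨γ, hγ, hγx⟩ := hΓ (fun i => c y i / c x₀ i) fun i => div_ne_zero (hy i) (hx₀ i)
      have hγy : γ x₀ = y := by
        apply c.injective
        ext i
        rw [hγx, div_mul_cancel₀ _ (hx₀ i)]
      have h := hinv γ hγ x₀
      rw [hγy] at h
      simp only [MulMemClass.coe_mul, Pi.mul_apply, SubalgebraClass.coe_algebraMap,
        Pi.algebraMap_apply, Algebra.algebraMap_self, RingHom.id_apply]
      field_simp
      exact h
    rw [Algebra.mem_bot]
    refine ⟨(p : V → k) x₀ / (q : V → k) x₀, ?_⟩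
    conv_rhs => rw [hpq, map_mul]
    rw [mul_div_cancel_right₀ _ hq', ← IsScalarTower.algebraMap_apply]
  rw [torusComplexity, hbot]
  exact trdeg_eq_zero

/-- The inclusion of the coordinate subspace spanned by `C`. -/
noncomputable def coordinateInclusion (c : V ≃ₗ[k] (ι → k)) (C : Set ι) : (C → k) →ₗ[k] V :=
  c.symm.toLinearMap.comp (Function.ExtendByZero.linearMap k (Subtype.val : C → ι))

omit [Finite ι] [Infinite k] in
theorem coordinateInclusion_coord (c : V ≃ₗ[k] (ι → k)) {C : Set ι} (y : C → k) (i : C) :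
    c (coordinateInclusion c C y) i = y i := by
  simp [coordinateInclusion]

omit [Finite ι] [Infinite k] in
theorem coordinateInclusion_coord_eq_zero (c : V ≃ₗ[k] (ι → k)) {C : Set ι} (y : C → k) {i : ι}
    (hi : i ∉ C) : c (coordinateInclusion c C y) i = 0 := by
  simpa [coordinateInclusion] using
    Function.extend_apply' (f := (Subtype.val : C → ι)) y 0 i (by simpa using hi)

omit [Finite ι] [Infinite k] in
theorem coordinateInclusion_restrict (c : V ≃ₗ[k] (ι → k)) {C : Set ι} {x : V}
    (hx : Function.support (c x) ⊆ C) : coordinateInclusion c C (fun i => c x i) = x := by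
  apply c.injective
  ext i
  by_cases hi : i ∈ C
  · exact coordinateInclusion_coord c _ ⟨i, hi⟩
  · rw [coordinateInclusion_coord_eq_zero c _ hi]
    exact (Function.notMem_support.mp fun h => hi (hx h)).symm

/-- Restriction of regular functions to the coordinate subspace spanned by `C`. -/
noncomputable def coordinateRestriction (c : V ≃ₗ[k] (ι → k)) (C : Set ι) :
    regularFunctions k V →+* regularFunctions k (C → k) where
  toFun f := ⟨(f : V → k) ∘ coordinateInclusion c C, regularFunctions_comp_linear k _ f.2⟩
  map_zero' := rfl
  map_one' := rfl
  map_add' _ _ := rfl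
  map_mul' _ _ := rfl

omit [Finite ι] [Infinite k] in
theorem coordinateRestriction_surjective (c : V ≃ₗ[k] (ι → k)) (C : Set ι) :
    Function.Surjective (coordinateRestriction c C) := by
  intro f
  refine ⟨⟨(f : (C → k) → k) ∘ ((LinearMap.funLeft k k Subtype.val).comp c.toLinearMap),
    regularFunctions_comp_linear k _ f.2⟩, Subtype.ext (funext fun y => ?_)⟩
  refine congrArg (f : (C → k) → k) (funext fun i => ?_)
  exact coordinateInclusion_coord c y i

/-- For a set `S` between the locus where exactly the coordinates in `C` are nonzero and the
coordinate subspace spanned by `C`, a regular function vanishes on `S` if and only if it vanishes on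
the whole subspace. -/
theorem ker_coordinateRestriction (c : V ≃ₗ[k] (ι → k)) {C : Set ι} {S : Set V}
    (h₁ : ∀ x, Function.support (c x) = C → x ∈ S)
    (h₂ : ∀ x ∈ S, Function.support (c x) ⊆ C) :
    RingHom.ker (coordinateRestriction c C) = vanishingIdealOf k S := by
  ext f
  rw [RingHom.mem_ker]
  constructor
  · intro hf x hx
    have := congrArg (fun g : regularFunctions k (C → k) => (g : (C → k) → k) fun i => c x i) hf
    simpa [coordinateRestriction, coordinateInclusion_restrict c (h₂ x hx)] using this
  · intro hf
    refine regularFunction_eq_of_eqOn_torus (LinearEquiv.refl k (C → k)) _ _ fun y hy => ?_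
    refine hf _ (h₁ _ (Set.ext fun i => ?_))
    by_cases hi : i ∈ C
    · simpa [hi, coordinateInclusion_coord c y ⟨i, hi⟩] using hy ⟨i, hi⟩
    · simp [hi, coordinateInclusion_coord_eq_zero c y hi]

theorem zariskiClosure_eq_coordinateSubspace (c : V ≃ₗ[k] (ι → k)) {C : Set ι} {S : Set V}
    (h₁ : ∀ x, Function.support (c x) = C → x ∈ S)
    (h₂ : ∀ x ∈ S, Function.support (c x) ⊆ C) :
    zariskiClosure k S = {x | Function.support (c x) ⊆ C} := by
  ext x
  constructor
  · intro hx i hi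
    by_contra hiC
    exact hi (hx ⟨fun x => c x i,
      dual_mem_regularFunctions ((LinearMap.proj i).comp c.toLinearMap)⟩
      fun y hy => Function.notMem_support.mp fun h => hiC (h₂ y hy h))
  · intro hx f hf
    rw [← ker_coordinateRestriction c h₁ h₂, RingHom.mem_ker] at hf
    have := congrArg (fun g : regularFunctions k (C → k) => (g : (C → k) → k) fun i => c x i) hf
    simpa [coordinateRestriction, coordinateInclusion_restrict c hx] using this

theorem zariskiDim_eq_ncard (c : V ≃ₗ[k] (ι → k)) {C : Set ι} {S : Set V}
    (h₁ : ∀ x, Function.support (c x) = C → x ∈ S)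
    (h₂ : ∀ x ∈ S, Function.support (c x) ⊆ C) :
    zariskiDim k S = ((C.ncard : ℕ) : WithBot ℕ∞) := by
  rw [zariskiDim, ← ker_coordinateRestriction c h₁ h₂, ringKrullDim_eq_of_ringEquiv
    (RingHom.quotientKerEquivOfSurjective (coordinateRestriction_surjective c C)),
    ringKrullDim_regularFunctions (LinearEquiv.refl k (C → k)), Nat.card_coe_set_eq]

/-! ### Orbits with coordinate subspaces as closures -/

section OrbitTypes

variable {Γ : Subgroup (V ≃ₗ[k] V)} {c : V ≃ₗ[k] (ι → k)} {C : V → Set ι}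

omit [Finite ι] [Infinite k] in
theorem orbitOf_eq_orbitOf_iff {x y : V} : orbitOf Γ x = orbitOf Γ y ↔ ∃ γ ∈ Γ, γ y = x := by
  refine Quotient.eq (r := MulAction.orbitRel Γ V).trans ?_
  rw [MulAction.orbitRel_apply, MulAction.mem_orbit_iff]
  exact ⟨fun ⟨γ, h⟩ => ⟨γ, γ.2, h⟩, fun ⟨γ, hγ, h⟩ => ⟨⟨γ, hγ⟩, h⟩⟩

/-- `C` classifies the orbits of `Γ` by coordinate subspaces: two points lie in one orbit if and
only if they have the same type, each point lies in the coordinate subspace given by its type, and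
the points of that subspace with all of its coordinates nonzero have this same type. -/
structure IsOrbitType (Γ : Subgroup (V ≃ₗ[k] V)) (c : V ≃ₗ[k] (ι → k)) (C : V → Set ι) : Prop where
  orbit_eq_iff : ∀ x y, orbitOf Γ x = orbitOf Γ y ↔ C x = C y
  support_subset : ∀ x, Function.support (c x) ⊆ C x
  eq_of_support_eq : ∀ x y, Function.support (c y) = C x → C y = C x

omit [Finite ι] [Infinite k] in
theorem IsOrbitType.mem_orbit_iff (h : IsOrbitType Γ c C) {x y : V} :
    y ∈ (orbitOf Γ x).toSet ↔ C y = C x := by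
  rw [← h.orbit_eq_iff]
  exact MulAction.orbitRel.Quotient.mem_orbit

theorem IsOrbitType.zariskiDim_orbit (h : IsOrbitType Γ c C) (x : V) :
    zariskiDim k (orbitOf Γ x).toSet = (((C x).ncard : ℕ) : WithBot ℕ∞) :=
  zariskiDim_eq_ncard c (fun y hy => h.mem_orbit_iff.mpr (h.eq_of_support_eq x y hy))
    fun y hy => h.mem_orbit_iff.mp hy ▸ h.support_subset y

theorem IsOrbitType.orbitOf_le_iff (h : IsOrbitType Γ c C) {x y : V} :
    orbitOf Γ x ≤ orbitOf Γ y ↔ C x ⊆ C y := by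
  have key : ∀ x, zariskiClosure k (orbitOf Γ x).toSet = {z | Function.support (c z) ⊆ C x} :=
    fun x => zariskiClosure_eq_coordinateSubspace c
      (fun y hy => h.mem_orbit_iff.mpr (h.eq_of_support_eq x y hy))
      fun y hy => h.mem_orbit_iff.mp hy ▸ h.support_subset y
  change zariskiClosure k _ ⊆ zariskiClosure k _ ↔ _
  classical
  rw [key, key]
  refine ⟨fun hxy => ?_, fun hxy z hz => hz.trans hxy⟩
  -- the indicator of `C x` is a point of the first subspace with the largest support
  have := @hxy (c.symm ((C x).indicator 1))
  simpa [Set.subset_def] using this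

/-- The adherence order is isomorphic to the inclusion order on the set of orbit types. -/
noncomputable def IsOrbitType.orderIso (h : IsOrbitType Γ c C) : OrbitSet k Γ ≃o Set.range C where
  toFun := Quotient.lift (fun x => ⟨C x, x, rfl⟩) fun x y hxy =>
    Subtype.ext ((h.orbit_eq_iff x y).mp (Quotient.sound hxy))
  invFun D := orbitOf Γ D.2.choose
  left_inv := by
    rintro ⟨x⟩
    exact (h.orbit_eq_iff _ x).mpr (Set.mem_range_self (f := C) x).choose_spec
  right_inv D := Subtype.ext D.2.choose_spec
  map_rel_iff' := by
    rintro ⟨x⟩ ⟨y⟩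
    exact h.orbitOf_le_iff.symm

end OrbitTypes

end Coordinates

/-! ### Set families graded by cardinality -/

section SetFamilies

variable {ι : Type*}

/-- A family of sets such that, whenever `D ⊂ E` are members, adding a suitable element of `E` to
`D` gives a member again. A family of finite sets with this property is graded by cardinality. -/
def IsOneStepFamily (A : Set (Set ι)) : Prop :=
  ∀ D ∈ A, ∀ E ∈ A, D ⊂ E → ∃ p ∈ E, p ∉ D ∧ insert p D ∈ A

theorem IsOneStepFamily.covBy_iff {A : Set (Set ι)} (hA : IsOneStepFamily A) {D E : A} :
    D ⋖ E ↔ ∃ p, p ∉ (D : Set ι) ∧ insert p (D : Set ι) = E := by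
  constructor
  · intro h
    obtain ⟨p, hpE, hpD, hp⟩ := hA D D.2 E E.2 h.lt
    refine ⟨p, hpD, ?_⟩
    by_contra hne
    have h₁ : (insert p D : Set ι) ⊆ E := Set.insert_subset hpE h.le
    exact h.2 (c := ⟨_, hp⟩) (Set.ssubset_insert hpD) (h₁.ssubset_of_ne hne)
  · rintro ⟨p, hpD, hp⟩
    have : (D : Set ι) ⋖ E := hp ▸ Set.covBy_insert hpD
    exact ⟨this.lt, fun F h₁ h₂ => this.2 h₁ h₂⟩

theorem mem_of_isMaxChain {α : Type*} [PartialOrder α] {s : Set α} (hs : IsMaxChain (· ≤ ·) s)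
    {a : α} (ha : ∀ b ∈ s, a ≤ b ∨ b ≤ a) : a ∈ s :=
  hs.2 (hs.1.insert fun b hb _ => ha b hb) (Set.subset_insert a s) ▸ Set.mem_insert a s

theorem IsOneStepFamily.ncard_isMaxChain [Finite ι] {A : Set (Set ι)} (hA : IsOneStepFamily A)
    (h₀ : ∅ ∈ A) (h₁ : Set.univ ∈ A) {s : Set A} (hs : IsMaxChain (· ≤ ·) s) :
    s.ncard = Nat.card ι + 1 := by
  have hlt : ∀ {D E : A}, D < E → (D : Set ι).ncard < (E : Set ι).ncard := fun h =>
    Set.ncard_lt_ncard h (Set.toFinite _)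
  have hinj : Set.InjOn (fun D : A => (D : Set ι).ncard) s := by
    intro D hD E hE hDE
    by_contra hne
    rcases hs.1.total hD hE with h | h
    · exact (hlt (lt_of_le_of_ne h hne)).ne hDE
    · exact (hlt (lt_of_le_of_ne h (Ne.symm hne))).ne' hDE
  have himage : (fun D : A => (D : Set ι).ncard) '' s = Set.Iic (Nat.card ι) := by
    apply Set.Subset.antisymm
    · rintro _ ⟨D, _, rfl⟩
      exact (Set.ncard_le_ncard (Set.subset_univ _)).trans_eq (Set.ncard_univ ι)
    · intro r
      induction r with
      | zero =>
        exact fun _ => ⟨⟨∅, h₀⟩, mem_of_isMaxChain hs fun E _ => Or.inl (Set.empty_subset _),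
          Set.ncard_empty ι⟩
      | succ r ih =>
        intro hr
        obtain ⟨D, hD, rfl⟩ := ih (Nat.le_of_succ_le hr)
        have huniv : (⟨Set.univ, h₁⟩ : A) ∈ s :=
          mem_of_isMaxChain hs fun E _ => Or.inr (Set.subset_univ _)
        have hDuniv : D < ⟨Set.univ, h₁⟩ := by
          refine lt_of_le_of_ne (Set.subset_univ _) ?_
          rintro rfl
          simp [Set.ncard_univ] at hr
        -- the next member of the chain after `D`
        obtain ⟨E, ⟨hE, hDE⟩, hmin⟩ := (Set.toFinite {E | E ∈ s ∧ D < E}).exists_minimal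
          ⟨_, huniv, hDuniv⟩
        obtain ⟨p, hpE, hpD, hp⟩ := hA D D.2 E E.2 hDE
        refine ⟨⟨_, hp⟩, mem_of_isMaxChain hs fun F hF => ?_, Set.ncard_insert_of_notMem hpD⟩
        rcases hs.1.total hF hD with h | h
        · exact Or.inr (le_trans (b := (D : Set ι)) h (Set.subset_insert _ _))
        · rcases h.eq_or_lt with rfl | h
          · exact Or.inr (Set.subset_insert _ _)
          · have hEF : E ≤ F := (hs.1.total hE hF).elim id fun h' => hmin ⟨hF, h⟩ h'
            exact Or.inl (Set.insert_subset (hEF hpE) (le_trans (a := D) h.le le_rfl))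
  rw [← hinj.ncard_image, himage, ← Finset.coe_Iic, Set.ncard_coe_finset,
    Nat.card_Iic]

end SetFamilies

/-! ### Matrix entries of the incidence monoid of the star -/

/-- The matrix positions at which an element of the incidence algebra of the star may be nonzero:
the corner `(1, 1)`, the rest `(1, j)` of the first row and the rest `(j, j)` of the diagonal. -/
inductive StarEntry (n : ℕ)
  | corner
  | row (j : Fin (n - 1))
  | diag (j : Fin (n - 1))

namespace StarEntry

/-- The matrix positions as an explicit disjoint sum. -/
def equivSum (n : ℕ) : StarEntry n ≃ Unit ⊕ Fin (n - 1) ⊕ Fin (n - 1) where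
  toFun
    | corner => .inl ()
    | row j => .inr (.inl j)
    | diag j => .inr (.inr j)
  invFun
    | .inl _ => corner
    | .inr (.inl j) => row j
    | .inr (.inr j) => diag j
  left_inv := by rintro (_ | _ | _) <;> rfl
  right_inv := by rintro (_ | _ | _) <;> rfl

instance (n : ℕ) : Finite (StarEntry n) := Finite.of_equiv _ (equivSum n).symm

theorem card_eq {n : ℕ} (hn : 1 ≤ n) : Nat.card (StarEntry n) = 2 * n - 1 := by
  rw [Nat.card_congr (equivSum n)]
  simp
  omega

end StarEntry

section Entries

open StarEntry

variable {k : Type*} [Field k] {n : ℕ}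

/-- The matrix with corner entry `a`, further entries `b` in the first row and further diagonal
entries `c`. -/
def starMatrix (a : k) (b c : Fin (n - 1) → k) : StarMonoid k n where
  toFun i j := Option.elim (α := Fin (n - 1)) i (Option.elim (α := Fin (n - 1)) j a b) fun i' =>
    Option.elim (α := Fin (n - 1)) j 0 fun j' => if i' = j' then c i' else 0
  eq_zero_of_not_le' := by
    rintro (_ | i) (_ | j) h
    · exact absurd le_rfl h
    · exact absurd (Or.inl rfl) h
    · rfl
    · exact if_neg fun hij => h (Or.inr (congrArg some hij))

variable (a : k) (b c : Fin (n - 1) → k) (j : Fin (n - 1))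

@[simp] theorem starMatrix_corner : starMatrix a b c root root = a := rfl

@[simp] theorem starMatrix_row : starMatrix a b c root (leaf j) = b j := rfl

@[simp] theorem starMatrix_diag : starMatrix a b c (leaf j) (leaf j) = c j := if_pos rfl

theorem entry_leaf_root (x : StarMonoid k n) : x (leaf j) root = 0 :=
  IncidenceAlgebra.apply_eq_zero_of_not_le (by rintro (h | h) <;> cases h) x

theorem entry_leaf_leaf (x : StarMonoid k n) {i j : Fin (n - 1)} (hij : i ≠ j) :
    x (leaf i) (leaf j) = 0 :=
  IncidenceAlgebra.apply_eq_zero_of_not_le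
    (by rintro (h | h) <;> cases h; exact hij rfl) x

theorem star_ext {x y : StarMonoid k n} (h₁ : x root root = y root root)
    (h₂ : ∀ j, x root (leaf j) = y root (leaf j))
    (h₃ : ∀ j, x (leaf j) (leaf j) = y (leaf j) (leaf j)) : x = y := by
  ext i j hij
  rcases i with _ | i <;> rcases j with _ | j
  · exact h₁
  · exact h₂ j
  · exact (entry_leaf_root _ x).trans (entry_leaf_root _ y).symm
  · obtain rfl | h := eq_or_ne i j
    · exact h₃ i
    · exact (entry_leaf_leaf x h).trans (entry_leaf_leaf y h).symm

@[simp] theorem mul_self_entry (x y : StarMonoid k n) (i : StarPoset n) :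
    (x * y) i i = x i i * y i i := by
  simp

@[simp] theorem mul_row (x y : StarMonoid k n) :
    (x * y) root (leaf j) =
      x root root * y root (leaf j) + x root (leaf j) * y (leaf j) (leaf j) := by
  have : Finset.Icc (root : StarPoset n) (leaf j) = {root, leaf j} := by
    ext z
    rw [Finset.mem_Icc]
    simp only [Finset.mem_insert, Finset.mem_singleton]
    exact ⟨fun h => h.2, fun h => ⟨Or.inl rfl, h⟩⟩
  rw [IncidenceAlgebra.mul_apply, this]
  exact Finset.sum_pair (Option.some_ne_none j).symm

attribute [-simp] IncidenceAlgebra.mul_apply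

@[simp] theorem one_self_entry (i : StarPoset n) : (1 : StarMonoid k n) i i = 1 := if_pos rfl

@[simp] theorem one_row : (1 : StarMonoid k n) root (leaf j) = 0 := by
  rw [IncidenceAlgebra.one_apply]
  exact if_neg (Option.some_ne_none j).symm

attribute [-simp] IncidenceAlgebra.one_apply

/-- The linear coordinates given by the matrix entries. -/
def starCoord (k : Type*) [Field k] (n : ℕ) : StarMonoid k n ≃ₗ[k] (StarEntry n → k) where
  toFun x
    | corner => x root root
    | row j => x root (leaf j)
    | diag j => x (leaf j) (leaf j)
  invFun v := starMatrix (v corner) (fun j => v (row j)) fun j => v (diag j)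
  map_add' x y := by ext (_ | _ | _) <;> rfl
  map_smul' t x := by ext (_ | _ | _) <;> rfl
  left_inv x := by apply star_ext <;> simp
  right_inv v := by ext (_ | _ | _) <;> simp

@[simp] theorem starCoord_corner (x : StarMonoid k n) : starCoord k n x corner = x root root := rfl

@[simp] theorem starCoord_row (x : StarMonoid k n) :
    starCoord k n x (row j) = x root (leaf j) := rfl

@[simp] theorem starCoord_diag (x : StarMonoid k n) :
    starCoord k n x (diag j) = x (leaf j) (leaf j) := rfl

/-- An invertible element of the incidence monoid, given by its entries. -/
def starUnit (a : k) (b c : Fin (n - 1) → k) (ha : a ≠ 0) (hc : ∀ j, c j ≠ 0) :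
    (StarMonoid k n)ˣ where
  val := starMatrix a b c
  inv := starMatrix a⁻¹ (fun j => -(a⁻¹ * b j * (c j)⁻¹)) fun j => (c j)⁻¹
  val_inv := by
    apply star_ext
    · simp [ha]
    · intro j
      simp only [mul_row, starMatrix_corner, starMatrix_row, starMatrix_diag, one_row]
      field_simp
      ring
    · intro j
      simp [hc j]
  inv_val := by
    apply star_ext
    · simp [ha]
    · intro j
      simp [hc j]
    · intro j
      simp [hc j]

@[simp] theorem starUnit_val (a : k) (b c : Fin (n - 1) → k) (ha : a ≠ 0) (hc : ∀ j, c j ≠ 0) :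
    (starUnit a b c ha hc : StarMonoid k n) = starMatrix a b c := rfl

theorem starUnit_inv (a : k) (b c : Fin (n - 1) → k) (ha : a ≠ 0) (hc : ∀ j, c j ≠ 0) :
    (((starUnit a b c ha hc)⁻¹ : (StarMonoid k n)ˣ) : StarMonoid k n) =
      starMatrix a⁻¹ (fun j => -(a⁻¹ * b j * (c j)⁻¹)) fun j => (c j)⁻¹ := rfl

theorem unit_self_entry_ne_zero (u : (StarMonoid k n)ˣ) (i : StarPoset n) :
    (u : StarMonoid k n) i i ≠ 0 := by
  intro h
  have := congrArg (fun x : StarMonoid k n => x i i) u.mul_inv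
  simp only [mul_self_entry, h, zero_mul, one_self_entry] at this
  exact zero_ne_one this

theorem starUnit_mem_diagonalTorus (a : k) (c : Fin (n - 1) → k) (ha : a ≠ 0)
    (hc : ∀ j, c j ≠ 0) : starUnit a (fun _ => 0) c ha hc ∈ diagonalTorus k n := by
  have key : ∀ (a : k) (c : Fin (n - 1) → k) (i j : StarPoset n), i ≠ j →
      starMatrix a (fun _ => 0) c i j = 0 := by
    rintro a c (_ | i) (_ | j) hij
    · exact absurd rfl hij
    · rfl
    · rfl
    · exact if_neg fun h => hij (congrArg some h)
  intro i j hij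
  refine ⟨key _ _ i j hij, ?_⟩
  rw [starUnit_inv]
  simpa using key _ _ i j hij

theorem mem_diagonalTorus_iff {u : (StarMonoid k n)ˣ} :
    u ∈ diagonalTorus k n ↔ ∀ j, (u : StarMonoid k n) root (leaf j) = 0 := by
  refine ⟨fun h j => (h _ _ (Option.some_ne_none j).symm).1, fun h => ?_⟩
  convert starUnit_mem_diagonalTorus ((u : StarMonoid k n) root root)
    (fun j => (u : StarMonoid k n) (leaf j) (leaf j)) (unit_self_entry_ne_zero u _)
    fun j => unit_self_entry_ne_zero u _
  apply Units.ext
  apply star_ext <;> simp [h]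

theorem mem_doubleGroup_iff {S : Subgroup (StarMonoid k n)ˣ}
    {γ : StarMonoid k n ≃ₗ[k] StarMonoid k n} :
    γ ∈ doubleGroup k S ↔ ∃ g ∈ S, ∃ h ∈ S, ∀ x,
      γ x = (g : StarMonoid k n) * x * ((h⁻¹ : (StarMonoid k n)ˣ) : StarMonoid k n) := by
  rw [doubleGroup, Subgroup.mem_map]
  constructor
  · rintro ⟨⟨g, h⟩, ⟨hg, hh⟩, rfl⟩
    exact ⟨g, hg, h, hh, fun x => rfl⟩
  · rintro ⟨g, hg, h, hh, hγ⟩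
    exact ⟨(g, h), ⟨hg, hh⟩, LinearEquiv.ext fun x => (hγ x).symm⟩

theorem orbitOf_doubleGroup_eq_iff {S : Subgroup (StarMonoid k n)ˣ} {x y : StarMonoid k n} :
    orbitOf (doubleGroup k S) x = orbitOf (doubleGroup k S) y ↔
      ∃ g ∈ S, ∃ h ∈ S, (g : StarMonoid k n) * y = x * h := by
  rw [orbitOf_eq_orbitOf_iff]
  constructor
  · rintro ⟨γ, hγ, hyx⟩
    obtain ⟨g, hg, h, hh, hγ⟩ := mem_doubleGroup_iff.mp hγ
    exact ⟨g, hg, h, hh, by rw [← hyx, hγ, mul_assoc, Units.inv_mul, mul_one]⟩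
  · rintro ⟨g, hg, h, hh, hgh⟩
    refine ⟨doubleAction k _ (g, h), ⟨(g, h), ⟨hg, hh⟩, rfl⟩, ?_⟩
    change (g : StarMonoid k n) * y * ((h⁻¹ : (StarMonoid k n)ˣ) : StarMonoid k n) = x
    rw [hgh, mul_assoc, Units.mul_inv, mul_one]

end Entries

/-! ### Orbits of the torus -/

section TorusOrbits

open StarEntry

variable {k : Type*} [Field k] {n : ℕ}

attribute [-simp] IncidenceAlgebra.mul_apply IncidenceAlgebra.one_apply

/-- The torus `T × T` rescales the `2 n - 1` matrix entries independently. -/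
theorem exists_scaling (t : StarEntry n → k) (ht : ∀ p, t p ≠ 0) :
    ∃ γ ∈ doubleGroup k (diagonalTorus k n), ∀ x p,
      starCoord k n (γ x) p = t p * starCoord k n x p := by
  let g : (StarMonoid k n)ˣ := starUnit 1 (fun _ => 0) (fun j => t (diag j) / t (row j)) one_ne_zero
    fun j => div_ne_zero (ht _) (ht _)
  let h : (StarMonoid k n)ˣ := starUnit (t corner)⁻¹ (fun _ => 0) (fun j => (t (row j))⁻¹)
    (inv_ne_zero (ht _)) fun j => inv_ne_zero (ht _)
  have hg : g ∈ diagonalTorus k n := starUnit_mem_diagonalTorus _ _ _ _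
  have hh : h ∈ diagonalTorus k n := starUnit_mem_diagonalTorus _ _ _ _
  refine ⟨doubleAction k _ (g, h), ⟨(g, h), ⟨hg, hh⟩, rfl⟩, fun x p => ?_⟩
  have : doubleAction k _ (g, h) x = (g : StarMonoid k n) * x *
    ((h⁻¹ : (StarMonoid k n)ˣ) : StarMonoid k n) := rfl
  rw [this, starUnit_inv, starUnit_val]
  have := ht p
  rcases p with _ | j | j
  · simp [mul_comm]
  · simp [mul_comm]
  · have := ht (row j)
    simp
    field_simp

/-- The orbits of `T × T` are the sets of matrices with a given set of nonzero entries. -/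
theorem isOrbitType_support : IsOrbitType (doubleGroup k (diagonalTorus k n)) (starCoord k n)
    fun x => Function.support (starCoord k n x) where
  orbit_eq_iff x y := by
    constructor
    · intro h
      obtain ⟨g, hg, h, hh, hgh⟩ := orbitOf_doubleGroup_eq_iff.mp h
      have hg' := mem_diagonalTorus_iff.mp hg
      have hh' := mem_diagonalTorus_iff.mp hh
      ext (_ | j | j)
      · have := congrArg (fun z : StarMonoid k n => z root root = 0) hgh
        simpa [unit_self_entry_ne_zero, iff_comm] using not_congr (iff_of_eq this)
      · have := congrArg (fun z : StarMonoid k n => z root (leaf j) = 0) hgh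
        simpa [unit_self_entry_ne_zero, hg', hh', iff_comm] using not_congr (iff_of_eq this)
      · have := congrArg (fun z : StarMonoid k n => z (leaf j) (leaf j) = 0) hgh
        simpa [unit_self_entry_ne_zero, iff_comm] using not_congr (iff_of_eq this)
    · intro h
      classical
      have h' : ∀ p, starCoord k n x p = 0 ↔ starCoord k n y p = 0 := fun p =>
        not_iff_not.mp (Set.ext_iff.mp h p)
      obtain ⟨γ, hγ, hγ'⟩ := exists_scaling
        (fun p => if starCoord k n y p = 0 then 1 else starCoord k n x p / starCoord k n y p) (by
          intro p
          split_ifs with hp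
          · exact one_ne_zero
          · exact div_ne_zero (mt (h' p).mp hp) hp)
      refine orbitOf_eq_orbitOf_iff.mpr ⟨γ, hγ, (starCoord k n).injective (funext fun p => ?_)⟩
      rw [hγ']
      split_ifs with hp
      · rw [hp, mul_zero, (h' p).mpr hp]
      · exact div_mul_cancel₀ _ hp
  support_subset x := subset_rfl
  eq_of_support_eq x y h := h

/-- The adherence order on the orbits of `T × T` is a Boolean lattice. -/
noncomputable def torusOrbitsOrderIso (k : Type*) [Field k] [Infinite k] {n : ℕ} (hn : 1 ≤ n) :
    TorusOrbits k n ≃o Set (Fin (2 * n - 1)) :=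
  have hrange : Set.range (fun x => Function.support (starCoord k n x)) = Set.univ := by
    classical
    refine Set.eq_univ_of_forall fun C => ⟨(starCoord k n).symm (C.indicator 1), ?_⟩
    simp
  (isOrbitType_support.orderIso.trans ((OrderIso.setCongr _ _ hrange).trans
    OrderIso.Set.univ)).trans
    (Equiv.toOrderIsoSet (Finite.equivFinOfCardEq (StarEntry.card_eq hn)))

end TorusOrbits

/-! ### Orbits of the unit group -/

section UnitOrbits

open StarEntry

variable {k : Type*} [Field k] {n : ℕ}

attribute [-simp] IncidenceAlgebra.mul_apply IncidenceAlgebra.one_apply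

/-- The lower sets of the order on the matrix positions in which each position `(1, j)` with `j ≠ 1`
lies below `(1, 1)` and below `(j, j)`. They index the orbits of `G × G`. -/
def starLowerSets (n : ℕ) : Set (Set (StarEntry n)) :=
  {C | (corner ∈ C → ∀ j, row j ∈ C) ∧ ∀ j, diag j ∈ C → row j ∈ C}

/-- The lower set generated by the positions of the nonzero entries of `x`. -/
def unitType (x : StarMonoid k n) : Set (StarEntry n) :=
  {p | match p with
    | corner => x root root ≠ 0
    | row j => x root root ≠ 0 ∨ x root (leaf j) ≠ 0 ∨ x (leaf j) (leaf j) ≠ 0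
    | diag j => x (leaf j) (leaf j) ≠ 0}

@[simp] theorem corner_mem_unitType {x : StarMonoid k n} :
    corner ∈ unitType x ↔ x root root ≠ 0 := Iff.rfl

@[simp] theorem row_mem_unitType {x : StarMonoid k n} {j : Fin (n - 1)} : row j ∈ unitType x ↔
    x root root ≠ 0 ∨ x root (leaf j) ≠ 0 ∨ x (leaf j) (leaf j) ≠ 0 := Iff.rfl

@[simp] theorem diag_mem_unitType {x : StarMonoid k n} {j : Fin (n - 1)} :
    diag j ∈ unitType x ↔ x (leaf j) (leaf j) ≠ 0 := Iff.rfl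

theorem unitType_mem_starLowerSets (x : StarMonoid k n) : unitType x ∈ starLowerSets n :=
  ⟨fun h _ => Or.inl h, fun _ h => Or.inr (Or.inr h)⟩

open Classical in
/-- The 0/1 matrix representing the orbit with index `C`. -/
noncomputable def normalForm (k : Type*) [Field k] {n : ℕ} (C : Set (StarEntry n)) :
    StarMonoid k n :=
  starMatrix (if corner ∈ C then 1 else 0)
    (fun j => if row j ∈ C ∧ corner ∉ C ∧ diag j ∉ C then 1 else 0)
    fun j => if diag j ∈ C then 1 else 0

theorem unitType_normalForm {C : Set (StarEntry n)} (hC : C ∈ starLowerSets n) :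
    unitType (normalForm k C) = C := by
  obtain ⟨h₁, h₂⟩ := hC
  ext (_ | j | j)
  · simp [normalForm]
  · by_cases hc : corner ∈ C
    · simp [normalForm, hc, h₁ hc]
    · by_cases hd : diag j ∈ C
      · simp [normalForm, hd, h₂ j hd]
      · simp [normalForm, hc, hd]
  · simp [normalForm]

theorem range_unitType : Set.range (unitType (k := k) (n := n)) = starLowerSets n :=
  Set.Subset.antisymm (Set.range_subset_iff.mpr unitType_mem_starLowerSets)
    fun _ hC => ⟨_, unitType_normalForm hC⟩

theorem normalForm_mem_orbitNormalForms (C : Set (StarEntry n)) :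
    normalForm k C ∈ orbitNormalForms k n := by
  classical
  refine ⟨?_, ?_, ?_⟩
  · rintro (_ | i) (_ | j)
    · exact (ite_eq_or_eq _ _ _).symm
    · exact (ite_eq_or_eq _ _ _).symm
    · exact Or.inl rfl
    · obtain rfl | h := eq_or_ne i j
      · change normalForm k C (leaf i) (leaf i) = 0 ∨ normalForm k C (leaf i) (leaf i) = 1
        rw [normalForm, starMatrix_diag]
        exact (ite_eq_or_eq _ _ _).symm
      · exact Or.inl (if_neg h)
  · have hcol : ∀ j, normalForm k C root (leaf j) = 1 → normalForm k C (leaf j) (leaf j) ≠ 1 := by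
      intro j
      simp only [normalForm, starMatrix_row, starMatrix_diag]
      by_cases hd : diag j ∈ C <;> simp [hd]
    have hleaf : ∀ i j, normalForm k C (leaf i) (leaf j) = 1 → i = j := by
      intro i j h
      by_contra hij
      exact zero_ne_one ((entry_leaf_leaf _ hij).symm.trans h)
    rintro (_ | i) (_ | i') (_ | j) h h'
    · rfl
    · rfl
    · exact absurd h' zero_ne_one
    · obtain rfl := hleaf _ _ h'
      exact absurd h' (hcol _ h)
    · exact absurd h zero_ne_one
    · obtain rfl := hleaf _ _ h
      exact absurd h (hcol _ h')
    · exact absurd h zero_ne_one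
    · rw [hleaf _ _ h, hleaf _ _ h']
  · intro h j
    by_cases hc : corner ∈ C
    · simp [normalForm, hc]
    · simp [normalForm, hc] at h

theorem normalForm_unitType {y : StarMonoid k n} (hy : y ∈ orbitNormalForms k n) :
    normalForm k (unitType y) = y := by
  classical
  obtain ⟨h₁, h₂, h₃⟩ := hy
  apply star_ext
  · rcases h₁ root root with h | h <;> simp [normalForm, h]
  · intro j
    have hcol := h₂ root (leaf j) (leaf j)
    rcases h₁ root root with h | h
    · rcases h₁ root (leaf j) with h' | h' <;> rcases h₁ (leaf j) (leaf j) with h'' | h''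
      · simp [normalForm, h, h', h'']
      · simp [normalForm, h, h', h'']
      · simp [normalForm, h, h', h'']
      · exact absurd (hcol h' h'') (Option.some_ne_none j).symm
    · simp [normalForm, h, h₃ h j]
  · intro j
    rcases h₁ (leaf j) (leaf j) with h | h <;> simp [normalForm, h]

/-- Row and column operations reduce every element to the representative of its type. -/
theorem orbitOf_normalForm (x : StarMonoid k n) :
    unitOrbit (normalForm k (unitType x)) = unitOrbit x := by
  classical
  refine (orbitOf_doubleGroup_eq_iff.mpr ?_).symm
  by_cases ha : x root root = 0
  -- rescale the nonzero `xⱼⱼ` to 1 and clear `x₁ⱼ` above them; rescale the remaining `x₁ⱼ` to 1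
  · refine ⟨starUnit 1 (fun j => if x (leaf j) (leaf j) = 0 then 0 else x root (leaf j))
      (fun j => if x (leaf j) (leaf j) = 0 then 1 else x (leaf j) (leaf j)) one_ne_zero
      (fun j => by split_ifs with h; exacts [one_ne_zero, h]), trivial,
      starUnit 1 (fun _ => 0) (fun j => if x (leaf j) (leaf j) = 0 ∧ x root (leaf j) ≠ 0 then
        (x root (leaf j))⁻¹ else 1) one_ne_zero
      (fun j => by split_ifs with h; exacts [inv_ne_zero h.2, one_ne_zero]), trivial, ?_⟩
    apply star_ext
    · simp [normalForm, ha]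
    · intro j
      by_cases hc : x (leaf j) (leaf j) = 0 <;> by_cases hb : x root (leaf j) = 0 <;>
        simp [normalForm, ha, hc, hb]
    · intro j
      by_cases hc : x (leaf j) (leaf j) = 0 <;> simp [normalForm, hc]
  -- rescale the nonzero diagonal entries to 1 and clear the first row by column operations
  · refine ⟨starUnit (x root root) (fun _ => 0)
      (fun j => if x (leaf j) (leaf j) = 0 then 1 else x (leaf j) (leaf j)) ha
      (fun j => by split_ifs with h; exacts [one_ne_zero, h]), trivial,
      starUnit 1 (fun j => -(x root (leaf j) / x root root)) (fun _ => 1) one_ne_zero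
      (fun j => one_ne_zero), trivial, ?_⟩
    apply star_ext
    · simp [normalForm, ha]
    · intro j
      simp [normalForm, ha, mul_div_cancel₀ _ ha]
    · intro j
      by_cases hc : x (leaf j) (leaf j) = 0 <;> simp [normalForm, hc]

/-- The closures of the orbits of `G × G` are the coordinate subspaces given by the lower sets of
matrix positions. -/
theorem isOrbitType_unitType :
    IsOrbitType (doubleGroup k (⊤ : Subgroup (StarMonoid k n)ˣ)) (starCoord k n) unitType where
  orbit_eq_iff x y := by
    constructor
    · intro h
      obtain ⟨g, -, h, -, hgh⟩ := orbitOf_doubleGroup_eq_iff.mp h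
      have h₁ : x root root = 0 ↔ y root root = 0 := by
        have := congrArg (fun z : StarMonoid k n => z root root = 0) hgh
        simpa [unit_self_entry_ne_zero, iff_comm] using this
      have h₂ : ∀ j, x (leaf j) (leaf j) = 0 ↔ y (leaf j) (leaf j) = 0 := by
        intro j
        have := congrArg (fun z : StarMonoid k n => z (leaf j) (leaf j) = 0) hgh
        simpa [unit_self_entry_ne_zero, iff_comm] using this
      ext (_ | j | j)
      · simp [h₁]
      · by_cases hx : x root root = 0
        · by_cases hx' : x (leaf j) (leaf j) = 0
          · have := congrArg (fun z : StarMonoid k n => z root (leaf j) = 0) hgh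
            have hy := h₁.mp hx
            have hy' := (h₂ j).mp hx'
            simp only [mul_row, hy', hx, mul_zero, zero_mul, add_zero, zero_add, mul_eq_zero,
              unit_self_entry_ne_zero, or_false, false_or, eq_iff_iff] at this
            simp [hx, hx', hy, hy', this]
          · simp [hx', mt (h₂ j).mpr hx']
        · simp [hx, mt h₁.mpr hx]
      · simp [h₂]
    · intro h
      exact (orbitOf_normalForm x).symm.trans (h ▸ orbitOf_normalForm y)
  support_subset x := by
    rintro (_ | j | j) h
    · exact h
    · exact Or.inr (Or.inl h)
    · exact h
  eq_of_support_eq x y h := by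
    obtain ⟨h₁, h₂⟩ := unitType_mem_starLowerSets x
    rw [← h] at h₁ h₂ ⊢
    ext (_ | j | j)
    · rfl
    · refine ⟨?_, fun h => Or.inr (Or.inl h)⟩
      rintro (h | h | h)
      · exact h₁ h j
      · exact h
      · exact h₂ j h
    · rfl

theorem unitOrbit_eq_iff {x y : StarMonoid k n} :
    unitOrbit x = unitOrbit y ↔ unitType x = unitType y :=
  isOrbitType_unitType.orbit_eq_iff x y

theorem existsUnique_normalForm (O : UnitOrbits k n) :
    ∃! y, y ∈ orbitNormalForms k n ∧ unitOrbit y = O := by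
  obtain ⟨x, rfl⟩ : ∃ x, unitOrbit x = O := Quotient.exists_rep O
  refine ⟨normalForm k (unitType x), ⟨normalForm_mem_orbitNormalForms _, orbitOf_normalForm x⟩, ?_⟩
  rintro y ⟨hy, hyx⟩
  rw [← unitOrbit_eq_iff.mp hyx, normalForm_unitType hy]

/-- The adherence order on the orbits of `G × G` is the inclusion order on the lower sets of matrix
positions. -/
noncomputable def unitOrbitsOrderIso (k : Type*) [Field k] [Infinite k] (n : ℕ) :
    UnitOrbits k n ≃o starLowerSets n :=
  isOrbitType_unitType.orderIso.trans (OrderIso.setCongr _ _ range_unitType)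

theorem isOneStepFamily_starLowerSets : IsOneStepFamily (starLowerSets n) := by
  rintro D ⟨hD₁, hD₂⟩ E ⟨hE₁, hE₂⟩ hDE
  by_cases h : ∃ j, row j ∈ E ∧ row j ∉ D
  · obtain ⟨j, hjE, hjD⟩ := h
    refine ⟨row j, hjE, hjD, ?_, ?_⟩
    · simpa using fun h i => Or.inr (hD₁ h i)
    · simpa using fun i h => Or.inr (hD₂ i h)
  · push Not at h
    obtain ⟨p, hpE, hpD⟩ := Set.exists_of_ssubset hDE
    refine ⟨p, hpE, hpD, fun hc i => Or.inr (h i (hE₁ ?_ i)),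
      fun i hi => Or.inr (h i (hE₂ i ?_))⟩
    · exact Set.insert_subset hpE hDE.subset hc
    · exact Set.insert_subset hpE hDE.subset hi

theorem ncard_isMaxChain_unitOrbits [Infinite k] (hn : 1 ≤ n) {s : Set (UnitOrbits k n)}
    (hs : IsMaxChain (· ≤ ·) s) : s.ncard = 2 * n := by
  rw [← Set.ncard_image_of_injective s (unitOrbitsOrderIso k n).injective,
    isOneStepFamily_starLowerSets.ncard_isMaxChain (by simp [starLowerSets])
      (by simp [starLowerSets]) (hs.image (unitOrbitsOrderIso k n)), StarEntry.card_eq hn]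
  omega

theorem unitOrbit_covBy_iff [Infinite k] {x y : StarMonoid k n} :
    unitOrbit y ⋖ unitOrbit x ↔ ∃ p, p ∉ unitType y ∧ insert p (unitType y) = unitType x := by
  rw [← apply_covBy_apply_iff (unitOrbitsOrderIso k n), isOneStepFamily_starLowerSets.covBy_iff]
  rfl

theorem ncard_starEntry_set (C : Set (StarEntry n)) : C.ncard =
    {_i : Unit | corner ∈ C}.ncard + {j | row j ∈ C}.ncard + {j | diag j ∈ C}.ncard := by
  have hC : C = (fun _ => corner) '' {_i : Unit | corner ∈ C} ∪ row '' {j | row j ∈ C} ∪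
      diag '' {j | diag j ∈ C} := by
    ext (_ | j | j) <;> simp
  conv_lhs => rw [hC]
  rw [Set.ncard_union_eq, Set.ncard_union_eq, Set.ncard_image_of_injective,
    Set.ncard_image_of_injective, Set.ncard_image_of_injective]
  · exact fun i j h => by injection h
  · exact fun i j h => by injection h
  · exact fun i j _ => rfl
  all_goals
    rw [Set.disjoint_left]
    rintro (_ | j | j) <;> simp

theorem orbitRank_eq_ncard {y : StarMonoid k n} (hy : y ∈ orbitNormalForms k n) :
    orbitRank y = (unitType y).ncard := by
  classical
  obtain ⟨h₁, h₂, h₃⟩ := hy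
  have hne : ∀ i j, y i j ≠ 0 ↔ y i j = 1 := by
    intro i j
    rcases h₁ i j with h | h <;> simp [h]
  rw [orbitRank, ncard_starEntry_set]
  simp only [corner_mem_unitType, row_mem_unitType, diag_mem_unitType, hne]
  split_ifs with hc
  · have hdiag : {i : StarPoset n | y i i = 1} =
        insert root (leaf '' {j | y (leaf j) (leaf j) = 1}) := by
      ext (_ | j)
      · exact iff_of_true hc (Set.mem_insert _ _)
      · constructor
        · exact fun h => Or.inr ⟨j, h, rfl⟩
        · rintro (h | ⟨i, h, h'⟩)
          · exact absurd h (Option.some_ne_none j)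
          · cases h'
            exact h
    rw [hdiag, Set.ncard_insert_of_notMem, Set.ncard_image_of_injective]
    · simp only [hc, true_or, Set.ofPred_true, Set.ncard_univ, Nat.card_eq_fintype_card,
        Fintype.card_unit, Fintype.card_fin]
      omega
    · exact Option.some_injective _
    · rintro ⟨i, -, h⟩
      exact Option.some_ne_none i h
  · have hrow : {j : Fin (n - 1) | y root root = 1 ∨ y root (leaf j) = 1 ∨
        y (leaf j) (leaf j) = 1} =
        {j | y (leaf j) (leaf j) = 1} ∪ {j | y root (leaf j) = 1} := by
      ext j
      simp [hc, or_comm]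
    rw [hrow, Set.ncard_union_eq]
    · simp only [hc, Set.ofPred_false, Set.ncard_empty]
      omega
    · rw [Set.disjoint_left]
      intro j h h'
      exact Option.some_ne_none j (h₂ _ _ _ h h')

theorem normalForm_corner {C : Set (StarEntry n)} :
    (normalForm k C root root = 1 ↔ corner ∈ C) ∧ (normalForm k C root root = 0 ↔ corner ∉ C) := by
  simp [normalForm]

theorem normalForm_row {C : Set (StarEntry n)} {j : Fin (n - 1)} :
    (normalForm k C root (leaf j) = 1 ↔ row j ∈ C ∧ corner ∉ C ∧ diag j ∉ C) ∧
      (normalForm k C root (leaf j) = 0 ↔ ¬(row j ∈ C ∧ corner ∉ C ∧ diag j ∉ C)) := by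
  simp [normalForm]

theorem normalForm_diag {C : Set (StarEntry n)} {j : Fin (n - 1)} :
    (normalForm k C (leaf j) (leaf j) = 1 ↔ diag j ∈ C) ∧
      (normalForm k C (leaf j) (leaf j) = 0 ↔ diag j ∉ C) := by
  simp [normalForm]

theorem normalForm_corner_eq_iff {C D : Set (StarEntry n)} :
    normalForm k D root root = normalForm k C root root ↔ (corner ∈ D ↔ corner ∈ C) := by
  simp only [normalForm, starMatrix_corner]
  split_ifs with h h' h' <;> simp [h, h']

theorem normalForm_row_eq_iff {C D : Set (StarEntry n)} {j : Fin (n - 1)} :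
    normalForm k D root (leaf j) = normalForm k C root (leaf j) ↔
      (row j ∈ D ∧ corner ∉ D ∧ diag j ∉ D ↔ row j ∈ C ∧ corner ∉ C ∧ diag j ∉ C) := by
  simp only [normalForm, starMatrix_row]
  split_ifs with h h' h' <;> simp [h, h']

theorem normalForm_diag_eq_iff {C D : Set (StarEntry n)} {j : Fin (n - 1)} :
    normalForm k D (leaf j) (leaf j) = normalForm k C (leaf j) (leaf j) ↔
      (diag j ∈ D ↔ diag j ∈ C) := by
  simp only [normalForm, starMatrix_diag]
  split_ifs with h h' h' <;> simp [h, h']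

theorem entries_eq_of_forall {x y : StarMonoid k n} {P : StarPoset n × StarPoset n → Prop}
    (h₁ : x root root = y root root)
    (h₂ : ∀ j, P (root, leaf j) → x root (leaf j) = y root (leaf j))
    (h₃ : ∀ j, P (leaf j, leaf j) → x (leaf j) (leaf j) = y (leaf j) (leaf j))
    (i j : StarPoset n) (h : P (i, j)) : x i j = y i j := by
  rcases i with _ | i <;> rcases j with _ | j
  · exact h₁
  · exact h₂ j h
  · exact (entry_leaf_root _ x).trans (entry_leaf_root _ y).symm
  · obtain rfl | hij := eq_or_ne i j
    · exact h₃ i h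
    · exact (entry_leaf_leaf x hij).trans (entry_leaf_leaf y hij).symm

theorem leaf_pair_ne {i r : Fin (n - 1)} :
    ((leaf i, leaf i) : StarPoset n × StarPoset n) ≠ (leaf r, leaf r) ↔ i ≠ r := by
  refine not_congr ⟨fun h => Option.some_injective _ (congrArg Prod.fst h), ?_⟩
  rintro rfl
  rfl

theorem root_leaf_pair_ne {i r : Fin (n - 1)} :
    ((root, leaf i) : StarPoset n × StarPoset n) ≠ (root, leaf r) ↔ i ≠ r := by
  refine not_congr ⟨fun h => Option.some_injective _ (congrArg Prod.snd h), ?_⟩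
  rintro rfl
  rfl

theorem root_leaf_pair_ne_leaf {j l : StarPoset n} {r : Fin (n - 1)} :
    ((root, j) : StarPoset n × StarPoset n) ≠ (leaf r, l) :=
  fun h => Option.some_ne_none r (congrArg Prod.fst h).symm

theorem insert_eq_of_normalFormCover {C D : Set (StarEntry n)} (hC : C ∈ starLowerSets n)
    (hD : D ∈ starLowerSets n) (h : NormalFormCover (normalForm k C) (normalForm k D)) :
    ∃ p, p ∉ C ∧ insert p C = D := by
  obtain ⟨hC₁, hC₂⟩ := hC
  obtain ⟨hD₁, hD₂⟩ := hD
  cases h with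
  | diagonal r hx₁ hy₁ hx hy h =>
    rw [normalForm_corner.1] at hx₁ hy₁
    rw [normalForm_diag.1] at hx
    rw [normalForm_diag.2] at hy
    refine ⟨diag r, hy, ?_⟩
    ext (_ | j | j)
    · simp [hx₁, hy₁]
    · simp [hC₁ hy₁ j, hD₁ hx₁ j]
    · obtain rfl | hj := eq_or_ne j r
      · simp [hx]
      · have := normalForm_diag_eq_iff.mp (h _ _ (leaf_pair_ne.mpr hj))
        simp [hj, this]
  | corner hx₁ hy₁ h hy =>
    rw [normalForm_corner.1] at hx₁
    rw [normalForm_corner.2] at hy₁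
    simp only [normalForm_diag_eq_iff, normalForm_row.1, normalForm_diag.2] at h hy
    refine ⟨corner, hy₁, ?_⟩
    ext (_ | j | j)
    · simp [hx₁]
    · have : row j ∈ C := by
        by_cases hj : diag j ∈ C
        · exact hC₂ j hj
        · exact ((hy j).mpr (mt (h j).mp hj)).1
      simp [hD₁ hx₁ j, this]
    · simp [h]
  | lift r hx₁ hy₁ hx hx' hy hy' h =>
    rw [normalForm_corner.2] at hx₁ hy₁
    rw [normalForm_diag.1] at hx
    rw [normalForm_diag.2] at hy
    rw [normalForm_row.1] at hy'
    have hdiag : ∀ j, j ≠ r → (diag j ∈ D ↔ diag j ∈ C) := fun j hj =>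
      normalForm_diag_eq_iff.mp (h _ _ root_leaf_pair_ne_leaf.symm (leaf_pair_ne.mpr hj))
    refine ⟨diag r, hy, ?_⟩
    ext (_ | j | j)
    · simp [hx₁, hy₁]
    · obtain rfl | hj := eq_or_ne j r
      · simp [hy'.1, hD₂ _ hx]
      · have := normalForm_row_eq_iff.mp
          (h _ _ (root_leaf_pair_ne.mpr hj) root_leaf_pair_ne_leaf)
        have hrow : row j ∈ C ↔ row j ∈ D := by
          by_cases hd : diag j ∈ C
          · exact iff_of_true (hC₂ j hd) (hD₂ j ((hdiag j hj).mpr hd))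
          · simpa [hx₁, hy₁, hd, mt (hdiag j hj).mp hd] using this.symm
        simp [hrow]
    · obtain rfl | hj := eq_or_ne j r
      · simp [hx]
      · simp [hj, hdiag j hj]
  | delete r hx₁ hy₁ hx hy h =>
    rw [normalForm_corner.2] at hx₁ hy₁
    rw [normalForm_row.1] at hx
    rw [normalForm_row.2] at hy
    have hdiag : ∀ j, (diag j ∈ D ↔ diag j ∈ C) := fun j =>
      normalForm_diag_eq_iff.mp (h _ _ root_leaf_pair_ne_leaf.symm)
    have hr : diag r ∉ C := mt (hdiag r).mpr hx.2.2
    refine ⟨row r, fun h => hy ⟨h, hy₁, hr⟩, ?_⟩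
    ext (_ | j | j)
    · simp [hx₁, hy₁]
    · obtain rfl | hj := eq_or_ne j r
      · simp [hx.1]
      · have := normalForm_row_eq_iff.mp (h _ _ (root_leaf_pair_ne.mpr hj))
        have hrow : row j ∈ C ↔ row j ∈ D := by
          by_cases hd : diag j ∈ C
          · exact iff_of_true (hC₂ j hd) (hD₂ j ((hdiag j).mpr hd))
          · simpa [hx₁, hy₁, hd, mt (hdiag j).mp hd] using this.symm
        simp [hj, hrow]
    · simp [hdiag]

theorem normalFormCover_insert {C : Set (StarEntry n)} {p : StarEntry n}
    (hC : C ∈ starLowerSets n) (hD : insert p C ∈ starLowerSets n) (hp : p ∉ C) :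
    NormalFormCover (normalForm k C) (normalForm k (insert p C)) := by
  obtain ⟨hC₁, hC₂⟩ := hC
  obtain ⟨hD₁, hD₂⟩ := hD
  rcases p with _ | r | r
  · refine .corner ?_ ?_ ?_ ?_
    · simp [normalForm_corner.1]
    · simpa [normalForm_corner.2] using hp
    · simp [normalForm_diag_eq_iff]
    · intro j
      have : row j ∈ C := by simpa using hD₁ (Set.mem_insert _ _) j
      simp [normalForm_row.1, normalForm_diag.2, this, hp]
  · have hr : diag r ∉ C := mt (hC₂ r) hp
    have hc : corner ∉ C := fun h => hp (hC₁ h r)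
    refine .delete r ?_ ?_ ?_ ?_ ?_
    · simpa [normalForm_corner.2] using hc
    · simpa [normalForm_corner.2] using hc
    · simp [normalForm_row.1, hr, hc]
    · simp [normalForm_row.2, hp]
    · refine entries_eq_of_forall (P := fun q => q ≠ (root, leaf r)) ?_ ?_ ?_
      · simp [normalForm_corner_eq_iff]
      · intro j hj
        rw [normalForm_row_eq_iff]
        simp [root_leaf_pair_ne.mp hj]
      · intro j _
        simp [normalForm_diag_eq_iff]
  · have hr : row r ∈ C := by simpa using hD₂ r (Set.mem_insert _ _)
    by_cases hc : corner ∈ C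
    · refine .diagonal r ?_ ?_ ?_ ?_ ?_
      · simpa [normalForm_corner.1] using hc
      · simpa [normalForm_corner.1] using hc
      · simp [normalForm_diag.1]
      · simpa [normalForm_diag.2] using hp
      · refine entries_eq_of_forall (P := fun q => q ≠ (leaf r, leaf r)) ?_ ?_ ?_
        · simp [normalForm_corner_eq_iff]
        · intro j _
          simp [normalForm_row_eq_iff, hc]
        · intro j hj
          simp [normalForm_diag_eq_iff, leaf_pair_ne.mp hj]
    · refine .lift r ?_ ?_ ?_ ?_ ?_ ?_ fun i j h h' => ?_
      · simpa [normalForm_corner.2] using hc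
      · simpa [normalForm_corner.2] using hc
      · simp [normalForm_diag.1]
      · simp [normalForm_row.2]
      · simpa [normalForm_diag.2] using hp
      · simp [normalForm_row.1, hr, hc, hp]
      · refine entries_eq_of_forall (P := fun q => q ≠ (root, leaf r) ∧ q ≠ (leaf r, leaf r))
          ?_ ?_ ?_ i j ⟨h, h'⟩
        · simp [normalForm_corner_eq_iff]
        · intro j hj
          rw [normalForm_row_eq_iff]
          simp [root_leaf_pair_ne.mp hj.1]
        · intro j hj
          simp [normalForm_diag_eq_iff, leaf_pair_ne.mp hj.2]

theorem normalFormCover_iff {x y : StarMonoid k n} (hx : x ∈ orbitNormalForms k n)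
    (hy : y ∈ orbitNormalForms k n) :
    NormalFormCover y x ↔ ∃ p, p ∉ unitType y ∧ insert p (unitType y) = unitType x := by
  have hC := unitType_mem_starLowerSets y
  have hD := unitType_mem_starLowerSets x
  rw [← normalForm_unitType hx, ← normalForm_unitType hy, unitType_normalForm hC,
    unitType_normalForm hD]
  refine ⟨insert_eq_of_normalFormCover hC hD, ?_⟩
  rintro ⟨p, hp, h⟩
  rw [← h] at hD ⊢
  exact normalFormCover_insert hC hD hp

/-- A lower set containing the corner contains the first row and is given by its diagonal part; a
lower set without the corner chooses one of three possibilities in each column. -/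
theorem card_starLowerSets : Nat.card (starLowerSets n) = 2 ^ (n - 1) + 3 ^ (n - 1) := by
  let f : Set (Fin (n - 1)) ⊕ (Fin (n - 1) → Fin 3) → Set (StarEntry n) := Sum.elim
    (fun S => insert corner (Set.range row ∪ diag '' S))
    fun c => row '' {j | c j ≠ 0} ∪ diag '' {j | c j = 2}
  have hf : Function.Injective f := by
    rintro (S | c) (S' | c') h
    · congr 1
      ext j
      simpa [f] using Set.ext_iff.mp h (diag j)
    · simpa [f] using Set.ext_iff.mp h corner
    · simpa [f] using Set.ext_iff.mp h corner
    · congr 1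
      ext1 j
      have h₁ : c j ≠ 0 ↔ c' j ≠ 0 := by simpa [f] using Set.ext_iff.mp h (row j)
      have h₂ : c j = 2 ↔ c' j = 2 := by simpa [f] using Set.ext_iff.mp h (diag j)
      omega
  have hrange : Set.range f = starLowerSets n := by
    classical
    apply Set.Subset.antisymm
    · rintro _ ⟨S | c, rfl⟩
      · simp [f, starLowerSets]
      · simp only [f, starLowerSets, Set.mem_ofPred_eq, Sum.elim_inr]
        refine ⟨by simp, fun j hj => ?_⟩
        have : c j = 2 := by simpa using hj
        simp [this]
    · rintro C ⟨h₁, h₂⟩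
      by_cases hc : corner ∈ C
      · refine ⟨.inl {j | diag j ∈ C}, ?_⟩
        ext (_ | j | j)
        · simp [f, hc]
        · simp [f, h₁ hc j]
        · simp [f]
      · refine ⟨.inr fun j => if diag j ∈ C then 2 else if row j ∈ C then 1 else 0, ?_⟩
        ext (_ | j | j)
        · simp [f, hc]
        · by_cases hj : diag j ∈ C <;> by_cases hj' : row j ∈ C <;> simp [f, hj, hj']
          exact absurd (h₂ j hj) hj'
        · by_cases hj : diag j ∈ C <;> by_cases hj' : row j ∈ C <;> simp [f, hj, hj']
  rw [← hrange, Nat.card_coe_set_eq, ← Set.image_univ, Set.ncard_image_of_injective _ hf,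
    Set.ncard_univ, Nat.card_sum]
  simp [Nat.card_eq_fintype_card]

end UnitOrbits

/-! ### The maximal torus -/

section Torus

/-- A homomorphism of linear groups given by a linear map of the ambient algebras pulls back
regular functions to regular functions. -/
theorem comp_mem_groupRegularFunctions {k : Type*} [Field k] {A B : Type*} [Ring A] [Algebra k A]
    [Ring B] [Algebra k B] {S : Subgroup Aˣ} {S' : Subgroup Bˣ} (θ : S →* S') (L : A →ₗ[k] B)
    (hL : ∀ u : S, ((θ u : Bˣ) : B) = L ((u : Aˣ) : A)) {f : S' → k}
    (hf : f ∈ groupRegularFunctions k S') : f ∘ θ ∈ groupRegularFunctions k S := by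
  unfold groupRegularFunctions at hf ⊢
  induction hf using Algebra.adjoin_induction with
  | mem f hf =>
    rcases hf with ⟨φ, rfl⟩ | ⟨φ, rfl⟩
    · exact Algebra.subset_adjoin (Or.inl ⟨φ.comp L, funext fun u => congrArg φ (hL u).symm⟩)
    · refine Algebra.subset_adjoin (Or.inr ⟨φ.comp L, funext fun u => congrArg φ ?_⟩)
      have := hL u⁻¹
      rw [map_inv] at this
      exact this.symm
  | algebraMap r => exact Subalgebra.algebraMap_mem _ r
  | add f g _ _ hf hg => exact Subalgebra.add_mem _ hf hg
  | mul f g _ _ hf hg => exact Subalgebra.mul_mem _ hf hg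

variable {k : Type*} [Field k] {n : ℕ}

attribute [-simp] IncidenceAlgebra.mul_apply IncidenceAlgebra.one_apply

/-- The algebra homomorphism that takes a matrix to its diagonal, with the positions numbered by
`e`. -/
def diagonalEntries {ι : Type*} (e : ι → StarPoset n) : StarMonoid k n →ₐ[k] (ι → k) :=
  AlgHom.ofLinearMap
    { toFun := fun x i => x (e i) (e i)
      map_add' := fun _ _ => rfl
      map_smul' := fun _ _ => rfl }
    (funext fun i => one_self_entry (e i)) fun x y => funext fun i => mul_self_entry x y (e i)

/-- The algebra homomorphism that takes a vector to the diagonal matrix with these entries. -/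
def diagonalMatrix {ι : Type*} (e : StarPoset n → ι) : (ι → k) →ₐ[k] StarMonoid k n :=
  AlgHom.ofLinearMap
    { toFun := fun v => starMatrix (v (e root)) (fun _ => 0) fun j => v (e (leaf j))
      map_add' := fun v w => by
        apply star_ext
        · rfl
        · intro j
          exact (add_zero (0 : k)).symm
        · intro j
          rw [IncidenceAlgebra.add_apply]
          simp
      map_smul' := fun t v => by
        apply star_ext
        · rfl
        · intro j
          exact (mul_zero t).symm
        · intro j
          rw [IncidenceAlgebra.constSMul_apply]
          simp }
    (by apply star_ext <;> simp) fun v w => by apply star_ext <;> simp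

theorem diagonalMatrix_apply {ι : Type*} (e : StarPoset n → ι) (v : ι → k) :
    diagonalMatrix e v = starMatrix (v (e root)) (fun _ => 0) fun j => v (e (leaf j)) := rfl

theorem diagonalEntries_diagonalMatrix {ι : Type*} (e : ι ≃ StarPoset n) (v : ι → k) :
    diagonalEntries e (diagonalMatrix e.symm v) = v := by
  ext i
  obtain ⟨p, rfl⟩ := e.symm.surjective i
  change diagonalMatrix e.symm v (e (e.symm p)) (e (e.symm p)) = _
  rw [e.apply_symm_apply, diagonalMatrix_apply]
  rcases p with _ | j
  · exact starMatrix_corner _ _ _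
  · exact starMatrix_diag _ _ _ j

theorem diagonalMatrix_diagonalEntries {ι : Type*} (e : ι ≃ StarPoset n) {x : StarMonoid k n}
    (hx : ∀ j, x root (leaf j) = 0) : diagonalMatrix e.symm (diagonalEntries e x) = x := by
  have : ∀ p, diagonalEntries e x (e.symm p) = x p p := fun p => by
    change x (e (e.symm p)) (e (e.symm p)) = _
    rw [e.apply_symm_apply]
  rw [diagonalMatrix_apply]
  apply star_ext
  · simp [this]
  · simp [hx]
  · simp [this]

/-- The diagonal subgroup is isomorphic to the group of units of `k ^ n`. -/
def diagonalTorusEquiv {ι : Type*} (e : ι ≃ StarPoset n) :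
    diagonalTorus k n ≃* (⊤ : Subgroup (ι → k)ˣ) where
  toFun u := ⟨Units.map (diagonalEntries (k := k) e).toRingHom.toMonoidHom u, trivial⟩
  invFun v := ⟨Units.map (diagonalMatrix (k := k) e.symm).toRingHom.toMonoidHom v,
    mem_diagonalTorus_iff.mpr fun j => starMatrix_row _ _ _ j⟩
  left_inv u := Subtype.ext (Units.ext
    (diagonalMatrix_diagonalEntries e (mem_diagonalTorus_iff.mp u.2)))
  right_inv _ := Subtype.ext (Units.ext (diagonalEntries_diagonalMatrix e _))
  map_mul' u v := Subtype.ext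
    (map_mul (Units.map (diagonalEntries (k := k) e).toRingHom.toMonoidHom)
      (u : (StarMonoid k n)ˣ) v)

theorem isTorus_diagonalTorus : IsTorus k (diagonalTorus k n) :=
  let e := (Fintype.equivFin (StarPoset n)).symm
  ⟨_, diagonalTorusEquiv e,
    fun _ hf => comp_mem_groupRegularFunctions (diagonalTorusEquiv e).toMonoidHom
      (diagonalEntries e).toLinearMap (fun _ => rfl) hf,
    fun _ hf => comp_mem_groupRegularFunctions (diagonalTorusEquiv e).symm.toMonoidHom
      (diagonalMatrix e.symm).toLinearMap (fun _ => rfl) hf⟩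

/-- The diagonal torus is its own centralizer, so no larger subgroup is commutative. -/
theorem maximal_isTorus_diagonalTorus [Infinite k] : Maximal (IsTorus k) (diagonalTorus k n) := by
  classical
  refine ⟨isTorus_diagonalTorus, ?_⟩
  rintro S ⟨m, e, -⟩ hTS u hu
  obtain ⟨a, ha⟩ := Infinite.exists_notMem_finset ({0, 1} : Finset k)
  simp only [Finset.mem_insert, Finset.mem_singleton, not_or] at ha
  have hd := hTS (starUnit_mem_diagonalTorus (n := n) a (fun _ => 1) ha.1 fun _ => one_ne_zero)
  have hcomm := e.injective ((map_mul e ⟨u, hu⟩ ⟨_, hd⟩).trans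
    ((mul_comm _ _).trans (map_mul e ⟨_, hd⟩ ⟨u, hu⟩).symm))
  refine mem_diagonalTorus_iff.mpr fun j => ?_
  have := congrArg (fun v : S => ((v : (StarMonoid k n)ˣ) : StarMonoid k n) root (leaf j)) hcomm
  simp only [Subgroup.coe_mul, Units.val_mul, mul_row, starUnit_val, starMatrix_row,
    starMatrix_diag, starMatrix_corner, mul_zero, mul_one, zero_mul, zero_add, add_zero] at this
  have h' : (1 - a) * (u : StarMonoid k n) root (leaf j) = 0 := by
    linear_combination this
  exact (mul_eq_zero.mp h').resolve_left (sub_ne_zero.mpr (Ne.symm ha.2))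

end Torus

/-! ### The group of algebraic semigroup automorphisms -/

section Automorphisms

open StarEntry

theorem exists_polynomial_of_mem_regularFunctions {k : Type*} [Field k] {f : k → k}
    (hf : f ∈ regularFunctions k k) : ∃ p : Polynomial k, ∀ a, p.eval a = f a := by
  unfold regularFunctions at hf
  induction hf using Algebra.adjoin_induction with
  | mem f hf =>
    obtain ⟨φ, rfl⟩ := hf
    refine ⟨Polynomial.C (φ 1) * Polynomial.X, fun a => ?_⟩
    have := φ.map_smul a 1
    simp only [smul_eq_mul, mul_one] at this
    rw [Polynomial.eval_mul, Polynomial.eval_C, Polynomial.eval_X, mul_comm, ← this]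
  | algebraMap r => exact ⟨Polynomial.C r, fun a => by simp⟩
  | add f g _ _ hf hg =>
    obtain ⟨p, hp⟩ := hf
    obtain ⟨q, hq⟩ := hg
    exact ⟨p + q, fun a => by simp [hp, hq]⟩
  | mul f g _ _ hf hg =>
    obtain ⟨p, hp⟩ := hf
    obtain ⟨q, hq⟩ := hg
    exact ⟨p * q, fun a => by simp [hp, hq]⟩

/-- An automorphism of the affine line that fixes `0` and `1` is the identity. -/
theorem eq_id_of_regular_automorphism {k : Type*} [Field k] [Infinite k] {f g : k → k}
    (hf : f ∈ regularFunctions k k) (hg : g ∈ regularFunctions k k) (hfg : ∀ a, f (g a) = a)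
    (h₀ : f 0 = 0) (h₁ : f 1 = 1) (a : k) : f a = a := by
  obtain ⟨p, hp⟩ := exists_polynomial_of_mem_regularFunctions hf
  obtain ⟨q, hq⟩ := exists_polynomial_of_mem_regularFunctions hg
  have hpq : p.comp q = Polynomial.X := Polynomial.funext fun a => by simp [hp, hq, hfg]
  have hdeg : p.natDegree * q.natDegree = 1 := by
    rw [← Polynomial.natDegree_comp, hpq, Polynomial.natDegree_X]
  obtain ⟨b, c, rfl⟩ := Polynomial.exists_eq_X_add_C_of_natDegree_le_one
    (Nat.eq_one_of_mul_eq_one_right hdeg).le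
  rw [← hp] at h₀ h₁ ⊢
  simp only [Polynomial.eval_add, Polynomial.eval_mul, Polynomial.eval_C, Polynomial.eval_X,
    mul_zero, zero_add, mul_one] at h₀ h₁ ⊢
  rw [h₀, add_zero] at h₁ ⊢
  rw [h₁, one_mul]

/-- The action of the units of a monoid by conjugation. -/
def unitsConj (M : Type*) [Monoid M] : Mˣ →* MulAut M where
  toFun g :=
    { toFun := fun x => g * x * (g⁻¹ : Mˣ)
      invFun := fun x => (g⁻¹ : Mˣ) * x * g
      left_inv := fun x => by simp [mul_assoc]
      right_inv := fun x => by simp [mul_assoc]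
      map_mul' := fun x y => by simp [mul_assoc] }
  map_one' := by
    ext x
    simp
  map_mul' g h := by
    ext x
    simp [mul_assoc]

theorem unitsConj_apply {M : Type*} [Monoid M] (g : Mˣ) (x : M) :
    unitsConj M g x = g * x * (g⁻¹ : Mˣ) := rfl

theorem mem_algebraicAut_of_linear {k : Type*} [Field k] {A : Type*} [Ring A] [Algebra k A]
    {F : MulAut A} (L L' : A →ₗ[k] A) (hL : ∀ x, F x = L x) (hL' : ∀ x, F.symm x = L' x) :
    F ∈ algebraicAut k A := by
  refine ⟨fun f hf => ?_, fun f hf => ?_⟩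
  · rw [show (F : A → A) = L from funext hL]
    exact regularFunctions_comp_linear k L hf
  · rw [show (F.symm : A → A) = L' from funext hL']
    exact regularFunctions_comp_linear k L' hf

theorem unitsConj_mem_algebraicAut {k : Type*} [Field k] {A : Type*} [Ring A] [Algebra k A]
    (g : Aˣ) : unitsConj A g ∈ algebraicAut k A :=
  mem_algebraicAut_of_linear (doubleAction k A (g, g)).toLinearMap
    (doubleAction k A (g, g)).symm.toLinearMap (fun _ => rfl) fun _ => rfl

variable {k : Type*} [Field k] {n : ℕ}

attribute [-simp] IncidenceAlgebra.mul_apply IncidenceAlgebra.one_apply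

theorem permAction_apply (σ : Equiv.Perm (Fin (n - 1))) (x : StarMonoid k n) (i j : StarPoset n) :
    permAction k n σ x i j = x ((permIso σ).symm i) ((permIso σ).symm j) := rfl

theorem permAction_diag (σ : Equiv.Perm (Fin (n - 1))) (x : StarMonoid k n) (j : Fin (n - 1)) :
    permAction k n σ x (leaf j) (leaf j) = x (leaf (σ.symm j)) (leaf (σ.symm j)) := rfl

/-- The permutation of the matrix entries as a linear map. -/
def permLinear (k : Type*) [Field k] {n : ℕ} (σ : Equiv.Perm (Fin (n - 1))) :
    StarMonoid k n →ₗ[k] StarMonoid k n where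
  toFun := permAction k n σ
  map_add' _ _ := rfl
  map_smul' _ _ := rfl

theorem permAction_mem_algebraicAut (σ : Equiv.Perm (Fin (n - 1))) :
    permAction k n σ ∈ algebraicAut k (StarMonoid k n) :=
  mem_algebraicAut_of_linear (permLinear k σ) (permLinear k σ⁻¹) (fun _ => rfl) fun x => by
    change (permAction k n σ)⁻¹ x = permAction k n σ⁻¹ x
    rw [map_inv]

/-- A central unit commutes with every matrix, since every matrix becomes invertible after adding a
suitable scalar. -/
theorem center_commutes [Infinite k] {g : (StarMonoid k n)ˣ}
    (hg : g ∈ Subgroup.center (StarMonoid k n)ˣ) (x : StarMonoid k n) :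
    (g : StarMonoid k n) * x = x * g := by
  classical
  obtain ⟨t, ht⟩ := Infinite.exists_notMem_finset (Finset.univ.image fun i => - x i i)
  have hne : ∀ i, (x + t • (1 : StarMonoid k n)) i i ≠ 0 := by
    intro i h
    refine ht (Finset.mem_image.mpr ⟨i, Finset.mem_univ i, ?_⟩)
    rw [IncidenceAlgebra.add_apply, IncidenceAlgebra.constSMul_apply, one_self_entry] at h
    simp only [smul_eq_mul, mul_one] at h
    linear_combination -h
  obtain ⟨u, hu⟩ : ∃ u : (StarMonoid k n)ˣ, (u : StarMonoid k n) = x + t • 1 :=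
    ⟨starUnit _ (fun j => (x + t • (1 : StarMonoid k n)) root (leaf j)) _ (hne root)
      fun j => hne (leaf j), star_ext rfl (fun _ => rfl) fun j => starMatrix_diag _ _ _ j⟩
  have := congrArg Units.val (Subgroup.mem_center_iff.mp hg u)
  rw [Units.val_mul, Units.val_mul, hu, add_mul, mul_add] at this
  simpa using this.symm

/-- The semidirect product of the inner automorphisms and the permutations of the leaves, acting on
the incidence monoid. -/
noncomputable def starAutHom (k : Type*) [Field k] [Infinite k] (n : ℕ) :
    ((StarMonoid k n)ˣ ⧸ Subgroup.center (StarMonoid k n)ˣ)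
      ⋊[permActionUnitsModCenter k n] Equiv.Perm (Fin (n - 1)) →* MulAut (StarMonoid k n) :=
  SemidirectProduct.lift
    (QuotientGroup.lift _ (unitsConj (StarMonoid k n)) fun g hg => by
      ext1 x
      rw [unitsConj_apply, center_commutes hg, mul_assoc, Units.mul_inv, mul_one]
      rfl)
    (permAction k n) fun σ => by
      refine QuotientGroup.monoidHom_ext _ (MonoidHom.ext fun g => MulEquiv.ext fun x => ?_)
      change (permAction k n σ (g : StarMonoid k n)) * x *
          permAction k n σ ((g⁻¹ : (StarMonoid k n)ˣ) : StarMonoid k n) =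
        permAction k n σ ((g : StarMonoid k n) * (permAction k n σ)⁻¹ x *
          ((g⁻¹ : (StarMonoid k n)ˣ) : StarMonoid k n))
      rw [map_mul, map_mul, MulAut.apply_inv_self]

theorem starAutHom_apply [Infinite k] (g : (StarMonoid k n)ˣ) (σ : Equiv.Perm (Fin (n - 1)))
    (x : StarMonoid k n) : starAutHom k n ⟨QuotientGroup.mk g, σ⟩ x =
      (g : StarMonoid k n) * permAction k n σ x * (g⁻¹ : (StarMonoid k n)ˣ) := rfl

theorem starAutHom_mem_algebraicAut [Infinite k] (a) :
    starAutHom k n a ∈ algebraicAut k (StarMonoid k n) := by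
  obtain ⟨q, σ⟩ := a
  obtain ⟨g, rfl⟩ := QuotientGroup.mk_surjective q
  exact mul_mem (unitsConj_mem_algebraicAut g) (permAction_mem_algebraicAut σ)

theorem starAutHom_injective [Infinite k] : Function.Injective (starAutHom k n) := by
  classical
  rw [injective_iff_map_eq_one]
  rintro ⟨q, σ⟩ h
  obtain ⟨g, rfl⟩ := QuotientGroup.mk_surjective q
  have hcomm : ∀ x, (g : StarMonoid k n) * permAction k n σ x = x * g := by
    intro x
    have := DFunLike.congr_fun h x
    rwa [starAutHom_apply, MulAut.one_apply, Units.mul_inv_eq_iff_eq_mul] at this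
  have hσ : σ = 1 := by
    ext1 i
    by_contra hi
    have := congrArg (fun y : StarMonoid k n => y (leaf i) (leaf i))
      (hcomm (starMatrix 0 (fun _ => 0) (Pi.single i 1)))
    simp only [mul_self_entry, permAction_diag, starMatrix_diag, Pi.single_eq_same, one_mul]
      at this
    rw [Pi.single_eq_of_ne, mul_zero] at this
    · exact unit_self_entry_ne_zero g _ this.symm
    · rw [Ne, Equiv.symm_apply_eq]
      exact fun h => hi h.symm
  subst hσ
  have hg : g ∈ Subgroup.center (StarMonoid k n)ˣ := by
    refine Subgroup.mem_center_iff.mpr fun u => Units.ext ?_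
    have := hcomm u
    rw [map_one] at this
    exact this.symm
  exact SemidirectProduct.ext ((QuotientGroup.eq_one_iff g).mpr hg) rfl

/-! ### Every algebraic automorphism is the product of a permutation and a conjugation -/

/-- The matrix unit `E_{1j}`. -/
def rowUnit (k : Type*) [Field k] {n : ℕ} (j : Fin (n - 1)) : StarMonoid k n :=
  starMatrix 0 (Pi.single j 1) fun _ => 0

/-- The diagonal matrix unit `E_{pp}`. -/
def diagUnit (k : Type*) [Field k] {n : ℕ} (p : StarPoset n) : StarMonoid k n :=
  diagonalMatrix id (Pi.single p 1)

@[simp] theorem diagUnit_self_entry (p i : StarPoset n) :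
    diagUnit k p i i = if i = p then 1 else 0 := by
  rw [← Pi.single_apply]
  rcases i with _ | j
  · exact starMatrix_corner _ _ _
  · exact starMatrix_diag _ _ _ j

@[simp] theorem diagUnit_row (p : StarPoset n) (j : Fin (n - 1)) :
    diagUnit k p root (leaf j) = 0 := rfl

theorem diagUnit_mul (p q : StarPoset n) :
    diagUnit k p * diagUnit k q = if p = q then diagUnit k p else 0 := by
  rw [diagUnit, diagUnit, ← map_mul]
  split_ifs with h
  · rw [h, ← Pi.single_mul, one_mul]
  · rw [← map_zero (diagonalMatrix id)]
    congr 1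
    ext i
    obtain rfl | hi := eq_or_ne i p
    · simp [Pi.single_eq_of_ne h]
    · simp [Pi.single_eq_of_ne hi]

theorem diagUnit_ne_zero (p : StarPoset n) : diagUnit k p ≠ 0 := by
  intro h
  have := diagUnit_self_entry (k := k) p p
  rw [h, if_pos rfl] at this
  exact zero_ne_one this

theorem root_ne_leaf (j : Fin (n - 1)) : (root : StarPoset n) ≠ leaf j :=
  (Option.some_ne_none j).symm

theorem diagUnit_mul_mul_self (x : StarMonoid k n) (p : StarPoset n) :
    diagUnit k p * x * diagUnit k p = x p p • diagUnit k p := by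
  apply star_ext
  · rw [IncidenceAlgebra.constSMul_apply]
    by_cases h : root = p
    · subst h
      simp
    · simp [h]
  · intro j
    rw [IncidenceAlgebra.constSMul_apply]
    by_cases h : root = p
    · subst h
      simp [(root_ne_leaf _).symm]
    · simp [h]
  · intro j
    rw [IncidenceAlgebra.constSMul_apply]
    by_cases h : leaf j = p
    · subst h
      simp
    · simp [h]

theorem diagUnit_mul_mul_leaf (x : StarMonoid k n) (j : Fin (n - 1)) :
    diagUnit k root * x * diagUnit k (leaf j) = x root (leaf j) • rowUnit k j := by
  apply star_ext
  · rw [IncidenceAlgebra.constSMul_apply]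
    simp [rowUnit, root_ne_leaf]
  · intro i
    rw [IncidenceAlgebra.constSMul_apply]
    obtain rfl | h := eq_or_ne i j
    · simp [rowUnit]
    · have : leaf i ≠ leaf j := fun h' => h (Option.some_injective _ h')
      simp [rowUnit, this, h]
  · intro i
    rw [IncidenceAlgebra.constSMul_apply]
    simp [rowUnit, (root_ne_leaf i).symm]

theorem rowUnit_ne_zero (j : Fin (n - 1)) : rowUnit k j ≠ 0 := by
  intro h
  have := congrArg (fun x : StarMonoid k n => x root (leaf j)) h
  simp only [rowUnit, starMatrix_row, Pi.single_eq_same] at this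
  exact one_ne_zero this

theorem eq_smul_one_of_commutes {y : StarMonoid k n} (hy : ∀ x, y * x = x * y) :
    y = y root root • 1 := by
  apply star_ext
  · rw [IncidenceAlgebra.constSMul_apply]
    simp
  · intro j
    rw [IncidenceAlgebra.constSMul_apply]
    have := congrArg (fun x : StarMonoid k n => x root (leaf j)) (hy (diagUnit k root))
    simpa [(root_ne_leaf _).symm] using this.symm
  · intro j
    rw [IncidenceAlgebra.constSMul_apply]
    have := congrArg (fun x : StarMonoid k n => x root (leaf j)) (hy (rowUnit k j))
    simpa [rowUnit] using this.symm

/-- Multiplicative bijections preserve the scalar matrices, which are the central elements. -/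
theorem map_smul_one (F : MulAut (StarMonoid k n)) (a : k) :
    F (a • 1) = F (a • 1) root root • 1 := by
  refine eq_smul_one_of_commutes fun x => ?_
  obtain ⟨x, rfl⟩ := F.surjective x
  rw [← map_mul, ← map_mul, smul_one_mul, mul_smul_one]

theorem scalarPart_mem_regularFunctions {F : MulAut (StarMonoid k n)}
    (hF : ∀ f ∈ regularFunctions k (StarMonoid k n), f ∘ F ∈ regularFunctions k (StarMonoid k n)) :
    (fun a : k => F (a • 1) root root) ∈ regularFunctions k k := by
  have := hF _ (dual_mem_regularFunctions
    ((LinearMap.proj corner).comp (starCoord k n).toLinearMap))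
  exact regularFunctions_comp_linear k (W := StarMonoid k n)
    (LinearMap.toSpanSingleton k (StarMonoid k n) 1) this

/-- An algebraic automorphism commutes with scalars, because it restricts to an automorphism of the
line of scalar matrices. -/
theorem algebraicAut_map_smul [Infinite k] {F : MulAut (StarMonoid k n)}
    (hF : F ∈ algebraicAut k (StarMonoid k n)) (a : k) (x : StarMonoid k n) :
    F (a • x) = a • F x := by
  have hid : F (a • 1) root root = a := by
    refine eq_id_of_regular_automorphism (scalarPart_mem_regularFunctions hF.1)
      (scalarPart_mem_regularFunctions (F := F.symm) hF.2) (fun b => ?_) ?_ ?_ a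
    · rw [← map_smul_one F.symm b, F.apply_symm_apply, IncidenceAlgebra.constSMul_apply]
      simp
    · rw [zero_smul, map_zero]
      rfl
    · rw [one_smul, map_one]
      simp
  rw [← smul_one_mul, map_mul, map_smul_one, hid, smul_one_mul]

/-- An algebraic automorphism fixing the diagonal matrix units is conjugation by a diagonal
matrix. -/
theorem eq_unitsConj_of_map_diagUnit [Infinite k] {F : MulAut (StarMonoid k n)}
    (hF : F ∈ algebraicAut k (StarMonoid k n)) (hE : ∀ p, F (diagUnit k p) = diagUnit k p) :
    ∃ d, F = unitsConj _ d := by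
  have hdiag : ∀ x p, F x p p = x p p := by
    intro x p
    have h := congrArg F (diagUnit_mul_mul_self x p)
    rw [map_mul, map_mul, algebraicAut_map_smul hF, hE, diagUnit_mul_mul_self] at h
    exact smul_left_injective k (diagUnit_ne_zero p) h
  let u : Fin (n - 1) → k := fun j => F (rowUnit k j) root (leaf j)
  have hrow : ∀ j, F (rowUnit k j) = u j • rowUnit k j := by
    intro j
    have h := congrArg F (diagUnit_mul_mul_leaf (rowUnit k j) j)
    rw [map_mul, map_mul, algebraicAut_map_smul hF, hE, hE, diagUnit_mul_mul_leaf] at h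
    rw [show u j = F (rowUnit k j) root (leaf j) from rfl, h]
    simp [rowUnit]
  have hu : ∀ j, u j ≠ 0 := by
    intro j hj
    have h := hrow j
    rw [hj, zero_smul] at h
    exact rowUnit_ne_zero j (F.injective (h.trans (map_zero F).symm))
  have hrow' : ∀ x j, F x root (leaf j) = x root (leaf j) * u j := by
    intro x j
    have h := congrArg F (diagUnit_mul_mul_leaf x j)
    rw [map_mul, map_mul, algebraicAut_map_smul hF, hE, hE, diagUnit_mul_mul_leaf, hrow,
      smul_smul] at h
    exact smul_left_injective k (rowUnit_ne_zero j) h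
  refine ⟨starUnit 1 (fun _ => 0) (fun j => (u j)⁻¹) one_ne_zero fun j => inv_ne_zero (hu j),
    MulEquiv.ext fun x => ?_⟩
  rw [unitsConj_apply, starUnit_inv, starUnit_val]
  apply star_ext
  · simp [hdiag]
  · intro j
    simp [hrow']
  · intro j
    have := hu j
    simp only [hdiag, mul_self_entry, starMatrix_diag]
    field_simp

/-- The diagonals of `n` orthogonal nonzero idempotents are the `n` unit vectors. -/
theorem exists_perm_of_orthogonal_idempotents {f : StarPoset n → StarMonoid k n}
    (hf : ∀ p q, f p * f q = if p = q then f p else 0) (hf₀ : ∀ p, f p ≠ 0) :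
    ∃ π : Equiv.Perm (StarPoset n), ∀ p i, f p i i = if i = π p then 1 else 0 := by
  have hne : ∀ p, ∃ i, f p i i ≠ 0 := by
    intro p
    by_contra! h
    refine hf₀ p ?_
    have := hf p p
    rw [if_pos rfl] at this
    rw [← this]
    apply star_ext
    · simp [h]
    · simp [h]
    · simp [h]
  choose π hπ using hne
  have horth : ∀ p q i, p ≠ q → f p i i ≠ 0 → f q i i = 0 := by
    intro p q i hpq hi
    have := congrArg (fun x : StarMonoid k n => x i i) (hf p q)
    rw [if_neg hpq] at this
    exact (mul_eq_zero.mp ((mul_self_entry _ _ i).symm.trans this)).resolve_left hi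
  have hinj : Function.Injective π := by
    intro p q h
    by_contra hpq
    exact hπ q (horth p q _ hpq (h ▸ hπ p))
  refine ⟨Equiv.ofBijective π hinj.bijective_of_finite, fun p i => ?_⟩
  rw [Equiv.ofBijective_apply]
  split_ifs with h
  · subst h
    have := congrArg (fun x : StarMonoid k n => x (π p) (π p)) (hf p p)
    rw [if_pos rfl] at this
    exact mul_left_cancel₀ (hπ p) (((mul_self_entry _ _ _).symm.trans this).trans (mul_one _).symm)
  · obtain ⟨q, rfl⟩ := Finite.surjective_of_injective hinj i
    exact horth q p _ (fun hqp => h (hqp ▸ rfl)) (hπ q)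

/-- A multiplicative bijection sends the diagonal matrix units, up to a permutation of the leaves,
to a conjugate family. The root is preserved since `E_{11} M E_{jj} ≠ 0`. -/
theorem exists_map_diagUnit (hn : 2 ≤ n) (F : MulAut (StarMonoid k n)) :
    ∃ (g : (StarMonoid k n)ˣ) (σ : Equiv.Perm (Fin (n - 1))), ∀ p,
      F (diagUnit k p) = unitsConj _ g (permAction k n σ (diagUnit k p)) := by
  have hzero : F 0 = 0 := map_zero F
  set f : StarPoset n → StarMonoid k n := fun p => F (diagUnit k p) with hfdef
  have hf : ∀ p q, f p * f q = if p = q then f p else 0 := by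
    intro p q
    simp only [hfdef]
    rw [← map_mul, diagUnit_mul]
    split_ifs
    · rfl
    · exact hzero
  obtain ⟨π, hπ⟩ := exists_perm_of_orthogonal_idempotents hf fun p h =>
    diagUnit_ne_zero p (F.injective (h.trans hzero.symm))
  have hroot : π root = root := by
    by_contra hne
    let j : Fin (n - 1) := ⟨0, by omega⟩
    have h₁ : f root root root = 0 := by rw [hπ, if_neg (Ne.symm hne)]
    have hrow : ∀ l, f root (leaf l) (leaf l) = 0 → f root root (leaf l) = 0 := by
      intro l hl
      have := congrArg (fun x : StarMonoid k n => x root (leaf l)) (hf root root)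
      rw [if_pos rfl] at this
      simpa [h₁, hl] using this.symm
    have hdisj : ∀ i, f root i i = 0 ∨ f (leaf j) i i = 0 := by
      intro i
      rw [hπ, hπ]
      by_cases h : i = π root
      · refine Or.inr (if_neg fun h' => root_ne_leaf j (π.injective (h.symm.trans h')))
      · exact Or.inl (if_neg h)
    have key : f root * F (rowUnit k j) * f (leaf j) = 0 := by
      apply star_ext
      · rw [mul_self_entry, mul_self_entry, h₁, zero_mul, zero_mul]
        rfl
      · intro l
        rw [mul_row, mul_self_entry, mul_row, h₁]
        rcases hdisj (leaf l) with h | h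
        · simp [hrow l h, IncidenceAlgebra.zero_apply]
        · simp [h, IncidenceAlgebra.zero_apply]
      · intro l
        rw [mul_self_entry, mul_self_entry]
        rcases hdisj (leaf l) with h | h
        · simp [h, IncidenceAlgebra.zero_apply]
        · simp [h, IncidenceAlgebra.zero_apply]
    rw [← hzero, ← map_mul, ← map_mul, diagUnit_mul_mul_leaf] at key
    have := F.injective key
    simp only [rowUnit, starMatrix_row, Pi.single_eq_same, one_smul] at this
    exact rowUnit_ne_zero j this
  let σ : Equiv.Perm (Fin (n - 1)) := Equiv.removeNone (α := Fin (n - 1)) (β := Fin (n - 1)) π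
  have hleaf : ∀ j, π (leaf j) = leaf (σ j) := by
    intro j
    refine (Equiv.removeNone_some (α := Fin (n - 1)) (β := Fin (n - 1)) π ?_).symm
    refine Option.ne_none_iff_exists'.mp fun h => root_ne_leaf j (π.injective (hroot.trans h.symm))
  have hσ : ∀ p, permAction k n σ (diagUnit k p) = diagUnit k (π p) := by
    intro p
    have hπσ : ∀ p, permIso σ p = π p := by
      rintro (_ | j)
      · exact hroot.symm
      · exact (hleaf j).symm
    have hdiag : ∀ i, permAction k n σ (diagUnit k p) i i = diagUnit k (π p) i i := by
      intro i
      rw [permAction_apply, diagUnit_self_entry, diagUnit_self_entry, ← hπσ]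
      exact if_congr (permIso σ).toEquiv.symm_apply_eq rfl rfl
    exact star_ext (hdiag _) (fun _ => rfl) fun _ => hdiag _
  -- orthogonality to `f root` determines the first rows of the other `f p`
  refine ⟨starUnit 1 (fun j => -f root root (leaf j)) (fun _ => 1) one_ne_zero
    fun _ => one_ne_zero, σ, fun p => ?_⟩
  rw [unitsConj_apply, Units.eq_mul_inv_iff_mul_eq, starUnit_val, hσ]
  change f p * _ = _
  apply star_ext
  · simp [hπ]
  · intro l
    obtain rfl | hp := eq_or_ne p root
    · simp [hπ, hroot, (root_ne_leaf _).symm]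
    · have hsum := congrArg (fun x : StarMonoid k n => x root (leaf l)) (hf root p)
      have hp' : root ≠ π p := fun h => hp (π.injective (hroot.trans h)).symm
      rw [if_neg hp.symm] at hsum
      simp only [mul_row, hπ root, hπ p, hroot, if_true, one_mul] at hsum
      simp only [mul_row, hπ p, if_neg hp', starMatrix_corner, starMatrix_row, starMatrix_diag,
        diagUnit_row, diagUnit_self_entry]
      rw [IncidenceAlgebra.zero_apply] at hsum
      linear_combination hsum
  · intro l
    simp [hπ]

theorem starAutHom_mk_one [Infinite k] (d : (StarMonoid k n)ˣ) :
    starAutHom k n ⟨QuotientGroup.mk d, 1⟩ = unitsConj _ d := by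
  ext1 x
  rw [starAutHom_apply, map_one]
  rfl

theorem algebraicAut_le_range_starAutHom [Infinite k] (hn : 2 ≤ n) :
    algebraicAut k (StarMonoid k n) ≤ (starAutHom k n).range := by
  intro F hF
  obtain ⟨g, σ, h⟩ := exists_map_diagUnit hn F
  obtain ⟨a, ha⟩ : ∃ a, ∀ x, starAutHom k n a x = unitsConj _ g (permAction k n σ x) :=
    ⟨⟨QuotientGroup.mk g, σ⟩, fun x => starAutHom_apply g σ x⟩
  obtain ⟨d, hd⟩ := eq_unitsConj_of_map_diagUnit
    (mul_mem (inv_mem (starAutHom_mem_algebraicAut a)) hF) fun p => by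
      rw [MulAut.mul_apply, h, ← ha, MulAut.inv_apply_self]
  rw [inv_mul_eq_iff_eq_mul] at hd
  rw [hd, ← starAutHom_mk_one]
  exact mul_mem ⟨_, rfl⟩ ⟨_, rfl⟩

/-- The group of algebraic semigroup automorphisms of the incidence monoid of the star. -/
noncomputable def starAutEquiv (k : Type*) [Field k] [Infinite k] {n : ℕ} (hn : 2 ≤ n) :
    ((StarMonoid k n)ˣ ⧸ Subgroup.center (StarMonoid k n)ˣ)
      ⋊[permActionUnitsModCenter k n] Equiv.Perm (Fin (n - 1)) ≃*
      algebraicAut k (StarMonoid k n) :=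
  MulEquiv.ofBijective ((starAutHom k n).codRestrict _ starAutHom_mem_algebraicAut)
    ⟨fun _ _ h => starAutHom_injective (congrArg Subtype.val h), fun F =>
      let ⟨a, ha⟩ := algebraicAut_le_range_starAutHom hn F.2
      ⟨a, Subtype.ext ha⟩⟩

end Automorphisms

theorem theorem4 {k : Type*} [Field k] [IsAlgClosed k] (n : ℕ) (hn : 2 ≤ n) :
    -- the diagonal torus is a maximal torus of the unit group
    Maximal (IsTorus k) (diagonalTorus k n) ∧
    -- the incidence monoid is a smooth toric variety of dimension `2n - 1`
    (IsToricFor k (doubleGroup k (diagonalTorus k n)) ∧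
      Algebra.Smooth k (regularFunctions k (StarMonoid k n)) ∧
      ringKrullDim (regularFunctions k (StarMonoid k n)) = ((2 * n - 1 : ℕ) : WithBot ℕ∞)) ∧
    -- the group of algebraic semigroup automorphisms
    (∃ e : ((StarMonoid k n)ˣ ⧸ Subgroup.center (StarMonoid k n)ˣ)
          ⋊[permActionUnitsModCenter k n] Equiv.Perm (Fin (n - 1)) ≃*
          algebraicAut k (StarMonoid k n),
      ∀ (g : (StarMonoid k n)ˣ) (σ : Equiv.Perm (Fin (n - 1))) (x : StarMonoid k n),
        (e ⟨QuotientGroup.mk g, σ⟩ : MulAut (StarMonoid k n)) x =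
          (g : StarMonoid k n) * permAction k n σ x * (g⁻¹ : (StarMonoid k n)ˣ)) ∧
    -- the adherence order for `T × T`
    (Nonempty (TorusOrbits k n ≃o Set (Fin (2 * n - 1))) ∧
      Nat.card (TorusOrbits k n) = 2 ^ (2 * n - 1)) ∧
    -- the adherence order for `G × G`: it is a graded partial order, with explicit
    -- representatives, rank function and covering relations
    ((∀ O O' : UnitOrbits k n, O ≤ O' → O' ≤ O → O = O') ∧
      (∀ O : UnitOrbits k n, ∃! y, y ∈ orbitNormalForms k n ∧ unitOrbit y = O) ∧
      (∀ s : Set (UnitOrbits k n), IsMaxChain (· ≤ ·) s → s.ncard = 2 * n) ∧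
      (∀ x ∈ orbitNormalForms k n,
        zariskiDim k (unitOrbit x).toSet = ((orbitRank x : ℕ) : WithBot ℕ∞)) ∧
      (∀ x ∈ orbitNormalForms k n, ∀ y ∈ orbitNormalForms k n,
        unitOrbit y ⋖ unitOrbit x → orbitRank x = orbitRank y + 1) ∧
      (∀ x ∈ orbitNormalForms k n, ∀ y ∈ orbitNormalForms k n,
        (unitOrbit y ⋖ unitOrbit x ↔ NormalFormCover y x)) ∧
      Nat.card (UnitOrbits k n) = 2 ^ (n - 1) + 3 ^ (n - 1)) := by
  have : Infinite k := IsAlgClosed.instInfinite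
  have hn₁ : 1 ≤ n := by omega
  refine ⟨maximal_isTorus_diagonalTorus, ⟨⟨regularFunctions_isDomain (starCoord k n),
    regularFunctions_isIntegrallyClosed (starCoord k n),
    torusComplexity_eq_zero (starCoord k n) _ exists_scaling⟩,
    regularFunctions_smooth (starCoord k n), ?_⟩,
    ⟨starAutEquiv k hn, fun g σ x => starAutHom_apply g σ x⟩,
    ⟨⟨torusOrbitsOrderIso k hn₁⟩, ?_⟩, ?_, existsUnique_normalForm,
    fun s hs => ncard_isMaxChain_unitOrbits hn₁ hs, ?_, ?_, ?_, ?_⟩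
  · rw [ringKrullDim_regularFunctions (starCoord k n), StarEntry.card_eq hn₁]
  · simp [Nat.card_congr (torusOrbitsOrderIso k hn₁).toEquiv, Nat.card_eq_fintype_card]
  · intro O O' h h'
    have e := unitOrbitsOrderIso k n
    exact e.injective (le_antisymm (e.monotone h) (e.monotone h'))
  · intro x hx
    rw [isOrbitType_unitType.zariskiDim_orbit, orbitRank_eq_ncard hx]
  · intro x hx y hy h
    obtain ⟨p, hp, hpx⟩ := unitOrbit_covBy_iff.mp h
    rw [orbitRank_eq_ncard hx, orbitRank_eq_ncard hy, ← hpx, Set.ncard_insert_of_notMem hp]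
  · intro x hx y hy
    rw [unitOrbit_covBy_iff, normalFormCover_iff hx hy]
  · rw [Nat.card_congr (unitOrbitsOrderIso k n).toEquiv, card_starLowerSets]
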